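/- **Definitions.** A *polynomial tree* $(F,T)$ is a locally finite simplicial tree $T$ without endpoints and with a unique isolated end, together with a proper, open, continuous simplicial map $F:T\to T$ such that the grand orbit of every vertex contains a vertex of valence $\ge 3$ and such that there is a local degree function $\deg$ (positive integers on vertices and edges) with $\deg(v)=\sum_{e\ni v,\ F(e)=F(e')}\deg(e)$ for every edge $e'$ at $v$, and $2\deg(v)-2\ge\sum_{e\ni v}(\deg(e)-1)$. Its degree is $d=\max_v\deg(v)\geq 2$. It is *metrized* by a height function $h>0$, affine on edges, with $h(F(v))=d\,h(v)$, where an edge $vw$ has length $|h(v)-h(w)|>0$ and $h$ is the distance to the set of non-isolated ends (so $h$ increases towards the isolated end). The level $l(v)$ is the least $l\ge 0$ such that $F^l(v)$ is at least as high as the highest vertex of valence $>2$, and the weight is $\mu(v)=d^{-l(v)}\prod_{i<l(v)}\deg(F^i(v))$. The *spine* $S(T)$ is the subtree consisting of all edges of degree $>1$. A *local model surface* $(X,\omega)$ is a planar Riemann surface with a holomorphic 1-form obtained from a rectangle $\{0<x<2\pi,\ h_{min}<y<h_{max}\}$, slit along finitely many vertical segments from the bottom up to a height $c_0\in(h_{min},h_{max})$,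 by gluing pairs of vertical edges by horizontal translations (at heights above $c_0$ so as to obtain one annulus of circumference $2\pi$), with $\omega=dz$; the function $y$ is its height function, the level set $y=c_0$ its central leaf, and its leaves are the connected components of the level sets of $y$. A *local model map* $f:(Y,\eta)\to(X,\omega)$ of degree $k$ is a holomorphic branched cover of degree $k$ with $\eta=\frac1k f^*\omega$ that sends the central leaf to the central leaf. A *tree of local models* $(\mathcal F,\mathcal X)$ over a metrized polynomial tree $(F,T,h)$ consists, for each vertex $v$ of $T$, of a local model surface $(X_v,\omega_v)$, a local model map $f_v:X_v\to X_{F(v)}$ of degree $\deg(v)$, and a marking $\pi_v$ from $X_v$ to the open star $T_v$ of $v$, inducing a homeomorphism from the space of leaves of $X_v$ to $T_v$ which is an isometry from the metric $\mu(v)|\omega_v|$ to the height metric (the central leaf lying over $v$ and the outer annulus over the edge above $v$), such that $\pi_{F(v)}\circ f_v=F\circ\pi_v$ and, for every edge $e$ at $v$, the degree of $f_v$ on the leaves over points of $e$ is $\deg(e)$. Here $\mathcal X=\bigsqcup_v X_v$ and $\mathcal F=\bigsqcup_v f_v$. Its *spine* is $\mathcal S=\bigsqcup_{v\in S(T)}X_v$,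 with first-return map $\mathcal R:\mathcal S\to\mathcal S$, $\mathcal R|_{X_v}=\mathcal F^{s(v)}$, $s(v)=\min\{i>0: F^i(v)\in S(T)\}$. An *equivalence* $(\mathcal F_1,\mathcal X_1)\to(\mathcal F_2,\mathcal X_2)$ is a bijective holomorphic isometry $\mathcal X_1\to\mathcal X_2$ (for the metrics $|\omega_v|$) that conjugates $\mathcal F_1$ to $\mathcal F_2$ and projects, via the markings, to an isometry $T_1\to T_2$ preserving heights and conjugating $F_1$ to $F_2$. An *isomorphism of first-return maps on spines* $(\mathcal R_1,\mathcal S_1)\to(\mathcal R_2,\mathcal S_2)$ is a bijective holomorphic isometry $j:\mathcal S_1\to\mathcal S_2$ with $\mathcal R_2\circ j=j\circ\mathcal R_1$ that projects, via the markings, to a simplicial isomorphism $S(T_1)\to S(T_2)$. **Proposition 4.2.** A tree of local models is uniquely determined by the first-return map on its spine. That is: let $(\mathcal F_1,\mathcal X_1)$ and $(\mathcal F_2,\mathcal X_2)$ be trees of local models over metrized polynomial trees $(F_1,T_1,h_1)$ and $(F_2,T_2,h_2)$, and let $j:(\mathcal R_1,\mathcal S_1)\to(\mathcal R_2,\mathcal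 S_2)$ be an isomorphism between the first-return maps on their spines. Then $j$ extends to an equivalence $(\mathcal F_1,\mathcal X_1)\to(\mathcal F_2,\mathcal X_2)$ (in particular $(F_1,T_1,h_1)$ and $(F_2,T_2,h_2)$ are isometrically conjugate), and this extension is unique. Moreover, for every vertex $v$ of $T_1$ not in $S(T_1)$, the local model map $f_v$ has degree $1$. -/

import Mathlib

open scoped Manifold ContDiff Topology

universe u

/-! ## Metrized polynomial trees -/

namespace SimpleGraph

variable {V : Type*} (G : SimpleGraph V)

/-- A ray in a graph: an infinite path without repeated vertices. -/
def IsRay (r : ℕ → V) : Prop :=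
  Function.Injective r ∧ ∀ n, G.Adj (r n) (r (n + 1))

/-- In a tree, two rays define the same end iff they agree after deleting initial segments. -/
def SameEnd (r s : ℕ → V) : Prop :=
  ∃ a b : ℕ, ∀ n, r (a + n) = s (b + n)

/-- The end of the ray `r` in a tree is isolated: beyond some edge of `r` the tree has no other end.
(The sets of ends lying beyond an edge of `r` form a neighbourhood basis of the end of `r`.) -/
def IsIsolatedEnd (r : ℕ → V) : Prop :=
  ∃ n, ∀ s, G.IsRay s → s 0 = r n → s 1 = r (n + 1) → SameEnd s r

/-- The valence of a vertex. -/
noncomputable def valence (v : V) : ℕ := (G.neighborSet v).ncard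

end SimpleGraph

/-- A tree dynamical system `F : T → T` of polynomial type, together with its local degree function.
The tree `T` is given by its graph of vertices and edges; the simplicial map `F`
is determined by its action on vertices. -/
structure PolynomialTree (V : Type*) where
  G : SimpleGraph V
  isTree : G.IsTree
  locallyFinite : ∀ v, (G.neighborSet v).Finite
  F : V → V
  /-- `F` is simplicial. (An open map collapses no edge.) -/
  map_adj : ∀ {v w}, G.Adj v w → G.Adj (F v) (F w)
  /-- `T` has no endpoints. -/
  no_endpoints : ∀ v, G.valence v ≠ 1
  /-- `T` has a unique isolated end. -/
  isolated_end : ∃ r, G.IsRay r ∧ G.IsIsolatedEnd r ∧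
    ∀ s, G.IsRay s → G.IsIsolatedEnd s → SimpleGraph.SameEnd s r
  /-- `F` is proper. -/
  proper : ∀ v, (F ⁻¹' {v}).Finite
  /-- `F` is open: the star of `v` is mapped onto the star of `F v`. -/
  isOpen : ∀ v w', G.Adj (F v) w' → ∃ w, G.Adj v w ∧ F w = w'
  /-- Every grand orbit of vertices contains a branching vertex. -/
  grand_orbit : ∀ v, ∃ w, 3 ≤ G.valence w ∧ ∃ m n, 0 < m ∧ 0 < n ∧ F^[m] v = F^[n] w
  /-- Local degrees of the vertices. -/
  degV : V → ℕ
  /-- Local degrees of the edges (values at pairs that are not edges play no role). -/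
  degE : Sym2 V → ℕ
  degV_pos : ∀ v, 0 < degV v
  degE_pos : ∀ e ∈ G.edgeSet, 0 < degE e
  /-- The degree of `v` is the sum of the degrees of the edges at `v` over a given edge at `F v`. -/
  degV_eq_sum : ∀ v w, G.Adj v w →
    degV v = ∑ᶠ u ∈ {u | G.Adj v u ∧ F u = F w}, degE s(v, u)
  riemann_hurwitz : ∀ v,
    ∑ᶠ w ∈ G.neighborSet v, ((degE s(v, w) : ℤ) - 1) ≤ 2 * (degV v : ℤ) - 2
  /-- The degree of `F`. -/
  d : ℕ
  two_le_d : 2 ≤ d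
  isGreatest_d : IsGreatest (Set.range degV) d

/-- A metrized polynomial tree `(F, T, h)`, given by its height function on vertices; an
edge `vw` has length `|h v - h w|` and is stretched by `F` by the factor `d`.  The height increases
towards the isolated end and decreases towards all other ends.  (These conditions make `h` tend
to `0` at every non-isolated end, so `h v` is the distance from `v` to the set of those ends.) -/
structure MetrizedPolynomialTree (V : Type*) extends PolynomialTree V where
  h : V → ℝ
  h_pos : ∀ v, 0 < h v
  h_map : ∀ v, h (F v) = d * h v
  /-- Of the edges at a vertex, exactly one goes up, the others go down. -/
  h_adj : ∀ v, ∃ w, G.Adj v w ∧ h v < h w ∧ ∀ u, G.Adj v u → u ≠ w → h u < h v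
  h_isolated : ∀ r, G.IsRay r → G.IsIsolatedEnd r → StrictMono fun n => h (r n)

namespace MetrizedPolynomialTree

variable {V : Type*} (T : MetrizedPolynomialTree V)

/-- The level of `v`: the least `l` such that `F^l v` is at least as high as the highest branching
vertex, i.e. as every branching vertex. -/
noncomputable def level (v : V) : ℕ :=
  sInf {l | ∀ u, 2 < T.G.valence u → T.h u ≤ T.h (T.F^[l] v)}

/-- The weight of `v`, i.e. the measure of the part of the Julia set of the tree below `v`. -/
noncomputable def weight (v : V) : ℝ :=
  (∏ i ∈ Finset.range (T.level v), (T.degV (T.F^[i] v) : ℝ)) / (T.d : ℝ) ^ T.level v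

/-- The vertices of the spine, the subtree consisting of all edges of degree `> 1`. -/
def spine : Set V := {v | ∃ w, T.G.Adj v w ∧ 1 < T.degE s(v, w)}

/-- The points of the tree (its geometric realization) in barycentric coordinates, with the
topology of pointwise convergence of the coordinates. -/
def points : Set (V → ℝ) :=
  {p | (∀ u, 0 ≤ p u) ∧ ∃ v w, T.G.Adj v w ∧ p v + p w = 1 ∧ ∀ u, u ≠ v → u ≠ w → p u = 0}

/-- The (open) star of a vertex: the vertex and its adjacent open edges. -/
def star (v : V) : Set (V → ℝ) := {p | p ∈ T.points ∧ 0 < p v}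

/-- The height function on points of the tree: the affine extension of `h` over the edges. -/
noncomputable def heightAt (p : V → ℝ) : ℝ := ∑ᶠ v, p v * T.h v

end MetrizedPolynomialTree

/-- The affine extension to barycentric coordinates of a map between vertex sets. -/
noncomputable def pushPoint {V W : Type*} (φ : V → W) (p : V → ℝ) : W → ℝ :=
  fun w => ∑ᶠ v ∈ φ ⁻¹' {w}, p v

/-! ## Local model surfaces and local model maps -/

/-- A 1-form of type `(1,0)` on a Riemann surface. -/
abbrev OneForm (X : Type*) [TopologicalSpace X] [ChartedSpace ℂ X] : Type _ :=
  ∀ x : X, TangentSpace 𝓘(ℂ) x →L[ℂ] ℂ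

/-- The 1-form is holomorphic: in every chart it is `g(z) dz` with `g` holomorphic. -/
def OneForm.IsHolomorphic {X : Type*} [TopologicalSpace X] [ChartedSpace ℂ X]
    (η : OneForm X) : Prop :=
  ∀ e ∈ atlas ℂ X, DifferentiableOn ℂ
    (fun z : ℂ => η (e.symm z) (mfderiv 𝓘(ℂ) 𝓘(ℂ) e.symm z (1 : ℂ))) e.target

/-- A presentation of `(X, η)`, with its height function, by the slit rectangle
`{0 < x < 2π, hmin < y < hmax} \ Σ`.  The slits are at the abscissas `a j`, `0 < j < n`
(and the rectangle has its vertical edges at `a 0 = 0` and `a n = 2π`); they go from the bottom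
up to height `c0`.  We cut the rectangle into the `n` strips `a j ≤ x ≤ a (j+1)`.  The right
edge of the strip `j` is glued by a horizontal translation, at heights `≥ c0`, to the left edge of
the next strip (cyclically: this restores the rectangle above the slits and closes it up to
an annulus), and at heights `≤ c0` to the left edge of the strip `σ j`. -/
structure RectangularPresentation {X : Type*} [TopologicalSpace X] [ChartedSpace ℂ X]
    (η : OneForm X) (height : X → ℝ) (hmin : EReal) (c0 : ℝ) (hmax : EReal) where
  n : ℕ
  a : Fin (n + 1) → ℝ
  a_strictMono : StrictMono a
  a_zero : a 0 = 0
  a_last : a (Fin.last n) = 2 * Real.pi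
  /-- The pairing of the vertical edges below `c0`. -/
  σ : Equiv.Perm (Fin n)
  /-- The map from the strips to the surface. -/
  P : Fin n × ℂ → X
  /-- The surface is the quotient of the disjoint union of the strips ... -/
  isQuotientMap : Topology.IsQuotientMap
    (Set.domRestrict {p : Fin n × ℂ | a p.1.castSucc ≤ p.2.re ∧ p.2.re ≤ a p.1.succ ∧
      hmin < (p.2.im : EReal) ∧ (p.2.im : EReal) < hmax} P)
  /-- ... by exactly the identifications described above. -/
  eq_iff : ∀ p q : {p : Fin n × ℂ | a p.1.castSucc ≤ p.2.re ∧ p.2.re ≤ a p.1.succ ∧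
      hmin < (p.2.im : EReal) ∧ (p.2.im : EReal) < hmax},
    P p = P q ↔ Relation.EqvGen
      (fun p q : {p : Fin n × ℂ | a p.1.castSucc ≤ p.2.re ∧ p.2.re ≤ a p.1.succ ∧
          hmin < (p.2.im : EReal) ∧ (p.2.im : EReal) < hmax} =>
        p.1.2.re = a p.1.1.succ ∧ q.1.2.re = a q.1.1.castSucc ∧ p.1.2.im = q.1.2.im ∧
          ((c0 ≤ p.1.2.im ∧ q.1.1 = finRotate n p.1.1) ∨
            (p.1.2.im ≤ c0 ∧ q.1.1 = σ p.1.1))) p q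
  /-- In the interior of the strips, the coordinate `z` is holomorphic and the form is `dz`. -/
  holomorphic : ∀ (j : Fin n) (z : ℂ), a j.castSucc < z.re → z.re < a j.succ →
    hmin < (z.im : EReal) → (z.im : EReal) < hmax →
    MDifferentiableAt 𝓘(ℂ) 𝓘(ℂ) (fun z => P (j, z)) z ∧
      η (P (j, z)) (mfderiv 𝓘(ℂ) 𝓘(ℂ) (fun z => P (j, z)) z (1 : ℂ)) = 1
  /-- The height function is the `y`-coordinate. -/
  height_eq : ∀ p : {p : Fin n × ℂ | a p.1.castSucc ≤ p.2.re ∧ p.2.re ≤ a p.1.succ ∧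
      hmin < (p.2.im : EReal) ∧ (p.2.im : EReal) < hmax}, height (P p) = p.1.2.im

/-- A local model surface: a planar Riemann surface with a holomorphic 1-form, obtained
from a slit rectangle. The distinguished height `c0` is part of the structure. -/
structure LocalModelSurface : Type (u + 1) where
  carrier : Type u
  [topologicalSpace : TopologicalSpace carrier]
  [t2Space : T2Space carrier]
  [connectedSpace : ConnectedSpace carrier]
  [chartedSpace : ChartedSpace ℂ carrier]
  [isManifold : IsManifold 𝓘(ℂ) ω carrier]
  form : OneForm carrier
  form_holomorphic : form.IsHolomorphic
  /-- The surface is planar, i.e. homeomorphic to a plane domain. -/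
  planar : ∃ e : carrier → ℂ, Topology.IsOpenEmbedding e
  height : carrier → ℝ
  hmin : EReal
  c0 : ℝ
  hmax : EReal
  hmin_lt : hmin < c0
  lt_hmax : c0 < hmax
  presentation : Nonempty (RectangularPresentation form height hmin c0 hmax)

instance : CoeSort LocalModelSurface.{u} (Type u) := ⟨LocalModelSurface.carrier⟩

attribute [instance] LocalModelSurface.topologicalSpace LocalModelSurface.t2Space
  LocalModelSurface.connectedSpace LocalModelSurface.chartedSpace LocalModelSurface.isManifold

namespace LocalModelSurface

/-- The central leaf. -/
def centralLeaf (X : LocalModelSurface) : Set X := {x | X.height x = X.c0}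

/-- The leaf of the horizontal foliation through `x`: the connected component of `x` in the level
set of the height function. -/
def leaf (X : LocalModelSurface) (x : X) : Set X :=
  connectedComponentIn {y | X.height y = X.height x} x

/-- A holomorphic branched cover of degree `k`: a proper holomorphic map that is
a `k`-sheeted covering away from finitely many points of the target. -/
def IsBranchedCover {Y X : LocalModelSurface} (f : Y → X) (k : ℕ) : Prop :=
  0 < k ∧ MDifferentiable 𝓘(ℂ) 𝓘(ℂ) f ∧ IsProperMap f ∧
    ∃ B : Set X, B.Finite ∧ IsCoveringMapOn f Bᶜ ∧ ∀ x ∉ B, (f ⁻¹' {x}).ncard = k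

/-- A local model map of degree `k`: a branched cover `f : (Y, η) → (X, ω)` of degree `k` with
`η = (1/k) f^* ω`, sending the central leaf to the central leaf. -/
structure IsLocalModelMap {Y X : LocalModelSurface} (f : Y → X) (k : ℕ) : Prop where
  isBranchedCover : IsBranchedCover f k
  pullback : ∀ (y : Y) (t : TangentSpace 𝓘(ℂ) y),
    Y.form y t = (1 / (k : ℂ)) * X.form (f y) (mfderiv 𝓘(ℂ) 𝓘(ℂ) f y t)
  central : Set.MapsTo f Y.centralLeaf X.centralLeaf

/-- A holomorphic isometry: a biholomorphic (i.e. bijective and holomorphic) map that is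
isometric for the conformal metrics defined by the absolute values of the 1-forms. -/
structure IsHolomorphicIsometry {Y X : LocalModelSurface} (f : Y → X) : Prop where
  bijective : Function.Bijective f
  holomorphic : MDifferentiable 𝓘(ℂ) 𝓘(ℂ) f
  isometry : ∀ (y : Y) (t : TangentSpace 𝓘(ℂ) y),
    ‖X.form (f y) (mfderiv 𝓘(ℂ) 𝓘(ℂ) f y t)‖ = ‖Y.form y t‖

end LocalModelSurface

open LocalModelSurface

/-! ## Trees of local models -/

/-- A tree of local models over a metrized polynomial tree. -/
structure TreeOfLocalModels {V : Type*} (T : MetrizedPolynomialTree V) where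
  /-- The local model surfaces `(X_v, ω_v)`. -/
  surf : V → LocalModelSurface.{u}
  /-- The local model maps `f_v`. -/
  map : ∀ v, surf v → surf (T.F v)
  /-- The markings, as maps from `X_v` to the star of `v`. -/
  mark : ∀ v, surf v → T.star v
  /-- The marking induces a homeomorphism to the star of `v` from the space of leaves of `X_v` ... -/
  mark_isQuotientMap : ∀ v, Topology.IsQuotientMap (mark v)
  mark_eq_iff : ∀ v x y, mark v x = mark v y ↔ y ∈ (surf v).leaf x
  /-- ... which is an isometry for the metric `weight v * |ω_v|` on the space of leaves and
  the height metric on the star. -/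
  mark_height : ∀ v x, T.heightAt (mark v x) =
    T.h v + T.weight v * ((surf v).height x - (surf v).c0)
  isLocalModelMap : ∀ v, IsLocalModelMap (map v) (T.degV v)
  /-- `F` on the star of `v` is the quotient of `f_v`. -/
  mark_map : ∀ v x, (mark (T.F v) (map v x) : V → ℝ) = pushPoint T.F (mark v x)
  /-- The local degree of an edge at `v` is the degree of `f_v` on the leaves over it. (Over `v`
  itself, the degree of `f_v` on the central leaf is the degree of `f_v`.) -/
  degE_eq : ∀ v w, T.G.Adj v w → ∀ x, 0 < (mark v x : V → ℝ) w →
    {y | map v y = map v x ∧ y ∈ (surf v).leaf x}.ncard = T.degE s(v, w)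

namespace TreeOfLocalModels

variable {V : Type*} {T : MetrizedPolynomialTree V} (M : TreeOfLocalModels.{u} T)

/-- The disjoint union of all the local model surfaces. -/
abbrev Total : Type _ := Σ v, M.surf v

/-- The bundled map of the total space to itself. -/
def totalMap : M.Total → M.Total := fun x => ⟨T.F x.1, M.map x.1 x.2⟩

/-- The spine of the tree of local models: the part lying over the spine of the tree. -/
abbrev Spine : Type _ := Σ v : T.spine, M.surf v

/-- The inclusion of the spine. -/
def incl : M.Spine → M.Total := fun x => ⟨x.1, x.2⟩

/-- The first return time to the spine. -/
noncomputable def returnTime (_M : TreeOfLocalModels.{u} T) (v : V) : ℕ :=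
  sInf {i | 0 < i ∧ T.F^[i] v ∈ T.spine}

/-- The first-return map on the spine (its values lie in the spine again). -/
noncomputable def firstReturn (x : M.Spine) : M.Total :=
  M.totalMap^[M.returnTime x.1] (M.incl x)

end TreeOfLocalModels

section Equivalences

variable {V₁ V₂ : Type*} {T₁ : MetrizedPolynomialTree V₁} {T₂ : MetrizedPolynomialTree V₂}

/-- An equivalence of trees of local models: a holomorphic isometry of the total spaces
conjugating the dynamics and projecting, via the markings, to an isometry of the trees
that conjugates the tree dynamics. -/
structure TLMEquiv (M₁ : TreeOfLocalModels.{u} T₁) (M₂ : TreeOfLocalModels.{u} T₂) where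
  tree : T₁.G ≃g T₂.G
  tree_map : ∀ v, tree (T₁.F v) = T₂.F (tree v)
  tree_height : ∀ v, T₂.h (tree v) = T₁.h v
  iso : ∀ v, M₁.surf v → M₂.surf (tree v)
  isHolomorphicIsometry : ∀ v, IsHolomorphicIsometry (iso v)
  mark_iso : ∀ v x, (M₂.mark (tree v) (iso v x) : V₂ → ℝ) = pushPoint tree (M₁.mark v x)
  conj : ∀ x : M₁.Total,
    Sigma.map tree iso (M₁.totalMap x) = M₂.totalMap (Sigma.map tree iso x)

/-- The map of total spaces underlying an equivalence. -/
def TLMEquiv.toMap {M₁ : TreeOfLocalModels.{u} T₁} {M₂ : TreeOfLocalModels.{u} T₂}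
    (E : TLMEquiv M₁ M₂) : M₁.Total → M₂.Total :=
  Sigma.map E.tree E.iso

/-- An isomorphism between the first-return maps on the spines of two trees of local models:
a holomorphic isometry of the spines conjugating the first-return maps and projecting, via
the markings, to a simplicial isomorphism of the spines of the trees (as far as the coordinates
with respect to vertices of the spine are concerned). -/
structure SpineEquiv (M₁ : TreeOfLocalModels.{u} T₁) (M₂ : TreeOfLocalModels.{u} T₂) where
  tree : T₁.G.induce T₁.spine ≃g T₂.G.induce T₂.spine
  iso : ∀ v : T₁.spine, M₁.surf v → M₂.surf (tree v)
  isHolomorphicIsometry : ∀ v, IsHolomorphicIsometry (iso v)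
  mark_iso : ∀ (v u : T₁.spine) (x : M₁.surf v),
    (M₂.mark (tree v) (iso v x) : V₂ → ℝ) (tree u) = (M₁.mark v x : V₁ → ℝ) u
  conj : ∀ x y : M₁.Spine, M₁.firstReturn x = M₁.incl y →
    M₂.firstReturn (Sigma.map tree iso x) = M₂.incl (Sigma.map tree iso y)

/-- The map of spines underlying an isomorphism of first-return maps. -/
def SpineEquiv.toMap {M₁ : TreeOfLocalModels.{u} T₁} {M₂ : TreeOfLocalModels.{u} T₂}
    (e : SpineEquiv M₁ M₂) : M₁.Spine → M₂.Spine :=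
  Sigma.map e.tree e.iso

end Equivalences

/-!
The idea is to reconstruct a tree of local models from its spine, going down the tree and using
that nothing happens off the spine.

Every vertex has a unique neighbour above it, its `parent`, and `F` commutes with `parent`. The
local degree of a vertex is the degree of the edge above it, so the spine consists of the vertices
of degree `> 1` and is closed under `parent`. Above the highest branching vertex `top` the tree is a
single ray, the `trunk`, which lies in the spine. Off the trunk, both `parent` and `F` decrease the
`depth` below the trunk (`depth_parent_lt`, `depth_map_lt`), so this number supports inductions
that use both.

Off the spine the local model maps have degree one and are therefore holomorphic isometries
(`IsLocalModelMap.isHolomorphicIsometry`). A holomorphic isometry between local model surfaces that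
respects the barycentric coordinate of the central vertex maps the annuli over the open edges at one
vertex bijectively to those at the other (`IsMarkedIsometry`). So, if `v` is not in the spine and
the extension is known over `parent v` and `F v`, the vertex corresponding to `v` is read off from
the image of the annulus over the edge from `parent v` to `v`, and the isometry over `v` is
the lift of the one over `F v` through the two local model maps of degree one. This is
`SpineEquiv.extend`; that it is a conjugacy, also over the spine, where only the first-return maps
are known to be conjugate, is `SpineEquiv.isGood`. The same two facts give uniqueness
(`TLMEquiv.toMap_eq_of_eqOn_spine`).

The isomorphism of spines is not assumed to respect heights. It respects the direction towards the
isolated end because first-return maps raise heights (`SpineEquiv.tree_spineParent`). An isometry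
cannot change the slope of the height in the coordinate of an edge, so corresponding edges have
lengths proportional to the weights (`IsMarkedIsometry.edge_length`). On the trunk the weights
are `1`, and `h (F top) - h top = (d - 1) * h top` then determines the height of `top`; below it,
the weight of a vertex is determined by its height and the degrees along its orbit, which gives the
heights of its children (`SpineEquiv.h_extend`).
-/

namespace MetrizedPolynomialTree

variable {V : Type*} (T : MetrizedPolynomialTree V)

/-! ### The ancestor structure of a metrized polynomial tree -/

/-- The parent of a vertex: its unique neighbour of greater height. -/
noncomputable def parent (v : V) : V := (T.h_adj v).choose

lemma adj_parent (v : V) : T.G.Adj v (T.parent v) := (T.h_adj v).choose_spec.1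

lemma h_lt_parent (v : V) : T.h v < T.h (T.parent v) := (T.h_adj v).choose_spec.2.1

lemma h_lt_of_adj_of_ne {v w : V} (hw : T.G.Adj v w) (hne : w ≠ T.parent v) : T.h w < T.h v :=
  (T.h_adj v).choose_spec.2.2 w hw hne

lemma eq_parent_of_adj_of_lt {v w : V} (hw : T.G.Adj v w) (hlt : T.h v < T.h w) :
    w = T.parent v := by
  by_contra hne
  exact lt_asymm hlt (T.h_lt_of_adj_of_ne hw hne)

lemma adj_iff {v w : V} : T.G.Adj v w ↔ w = T.parent v ∨ T.parent w = v := by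
  constructor
  · intro hw
    by_cases hne : w = T.parent v
    · exact Or.inl hne
    · exact Or.inr (T.eq_parent_of_adj_of_lt hw.symm (T.h_lt_of_adj_of_ne hw hne)).symm
  · rintro (rfl | rfl)
    · exact T.adj_parent v
    · exact (T.adj_parent w).symm

lemma parent_ne (v : V) : T.parent v ≠ v := fun h => (h ▸ T.h_lt_parent v).ne rfl

lemma d_pos : (0 : ℝ) < T.d := by
  have := T.two_le_d
  exact_mod_cast (by omega : 0 < T.d)

lemma one_lt_d : (1 : ℝ) < T.d := by
  have := T.two_le_d
  exact_mod_cast (by omega : 1 < T.d)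

lemma h_lt_map (v : V) : T.h v < T.h (T.F v) := by
  rw [T.h_map]
  nlinarith [T.h_pos v, T.one_lt_d]

lemma map_parent (v : V) : T.F (T.parent v) = T.parent (T.F v) := by
  refine T.eq_parent_of_adj_of_lt (T.map_adj (T.adj_parent v)) ?_
  rw [T.h_map, T.h_map]
  exact mul_lt_mul_of_pos_left (T.h_lt_parent v) T.d_pos

lemma map_parent_iterate (n : ℕ) (v : V) : T.F (T.parent^[n] v) = T.parent^[n] (T.F v) :=
  (Function.Semiconj.iterate_right (f := T.F) T.map_parent n) v

lemma h_iterate_map (n : ℕ) (v : V) : T.h (T.F^[n] v) = (T.d : ℝ) ^ n * T.h v := by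
  induction n with
  | zero => simp
  | succ n ih => rw [Function.iterate_succ_apply', T.h_map, ih]; ring

lemma h_strictMono_parent (v : V) : StrictMono fun n => T.h (T.parent^[n] v) :=
  strictMono_nat_of_lt_succ fun n => by
    rw [Function.iterate_succ_apply']; exact T.h_lt_parent _

lemma exists_common_ancestor (v w : V) : ∃ i j, T.parent^[i] v = T.parent^[j] w := by
  obtain ⟨p⟩ := T.isTree.connected.preconnected v w
  induction p with
  | nil => exact ⟨0, 0, rfl⟩
  | cons hadj _ ih =>
    obtain ⟨i, j, hij⟩ := ih
    rcases T.adj_iff.1 hadj with rfl | rfl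
    · exact ⟨i + 1, j, by rw [Function.iterate_succ_apply]; exact hij⟩
    · exact ⟨i, j + 1, by
        rw [← Function.iterate_succ_apply, Function.iterate_succ_apply', hij,
          Function.iterate_succ_apply']⟩

/-- Every vertex has a child, since the tree has no endpoints. -/
lemma exists_child (v : V) : ∃ w, T.parent w = v := by
  by_contra! hno
  apply T.no_endpoints v
  have : T.G.neighborSet v = {T.parent v} := by
    ext w
    simp only [SimpleGraph.mem_neighborSet, Set.mem_singleton_iff, T.adj_iff]
    exact ⟨fun h => h.resolve_right (hno w), Or.inl⟩
  rw [SimpleGraph.valence, this, Set.ncard_singleton]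

lemma eq_of_parent_eq_of_valence_lt {v w w' : V} (hv : T.G.valence v < 3)
    (hw : T.parent w = v) (hw' : T.parent w' = v) : w = w' := by
  by_contra hne
  have h1 : T.parent v ≠ w := by
    rintro rfl
    have := T.h_lt_parent v
    have := T.h_lt_parent (T.parent v)
    rw [hw] at this
    linarith
  have h2 : T.parent v ≠ w' := by
    rintro rfl
    have := T.h_lt_parent v
    have := T.h_lt_parent (T.parent v)
    rw [hw'] at this
    linarith
  have hsub : ({T.parent v, w, w'} : Set V) ⊆ T.G.neighborSet v := by
    rintro x (rfl | rfl | rfl)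
    · exact T.adj_parent v
    · exact T.adj_iff.2 (Or.inr hw)
    · exact T.adj_iff.2 (Or.inr hw')
  have hcard : ({T.parent v, w, w'} : Set V).ncard = 3 := by
    rw [Set.ncard_eq_three]; exact ⟨_, _, _, h1, h2, hne, rfl⟩
  have := Set.ncard_le_ncard hsub (T.locallyFinite v)
  rw [hcard] at this
  exact absurd hv (by simpa [SimpleGraph.valence] using this)

lemma exists_child_ne_of_valence {v : V} (hv : 3 ≤ T.G.valence v) (w : V) :
    ∃ w', T.parent w' = v ∧ w' ≠ w := by
  by_contra! hno
  have hsub : T.G.neighborSet v ⊆ {T.parent v, w} := by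
    intro x hx
    rcases T.adj_iff.1 hx with rfl | h
    · exact Or.inl rfl
    · exact Or.inr (hno x h)
  have := Set.ncard_le_ncard hsub
  have h2 := Set.ncard_insert_le (T.parent v) {w}
  rw [Set.ncard_singleton] at h2
  unfold SimpleGraph.valence at hv
  omega

/-- Far up along the ray to the isolated end there is no branching: descending into another branch
would give rays to other ends beyond every edge of that ray. -/
lemma exists_forall_valence_lt : ∃ v, ∀ i, T.G.valence (T.parent^[i] v) < 3 := by
  obtain ⟨r, hr, hiso, -⟩ := T.isolated_end
  have hmono := T.h_isolated r hr hiso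
  have hrp : ∀ n, r (n + 1) = T.parent (r n) := fun n =>
    T.eq_parent_of_adj_of_lt (hr.2 n) (hmono (Nat.lt_succ_self n))
  have hri : ∀ i n, T.parent^[i] (r n) = r (n + i) := by
    intro i n
    induction i with
    | zero => rfl
    | succ i ih => rw [Function.iterate_succ_apply', ih, ← hrp, Nat.add_assoc]
  obtain ⟨n, hn⟩ := hiso
  refine ⟨r (n + 1), fun i => ?_⟩
  rw [hri]
  by_contra! hval
  -- A child `u` of `r (n + 1 + i)` off the ray, and a descending sequence from `u`.
  obtain ⟨u, hu, hne⟩ := T.exists_child_ne_of_valence hval (r (n + i))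
  choose c hc using T.exists_child
  have hci : ∀ k w, T.parent^[k] (c^[k] w) = w := by
    intro k w
    exact Function.LeftInverse.iterate (f := c) hc k w
  set s : ℕ → V := fun k => if k ≤ i + 1 then r (n + k) else c^[k - (i + 2)] u with hs
  have hs1 : ∀ k, k ≤ i + 1 → s k = r (n + k) := fun k hk => by simp [hs, hk]
  have hs2 : ∀ k, s (i + 2 + k) = c^[k] u := fun k => by
    have : ¬ (i + 2 + k ≤ i + 1) := by omega
    simp [hs, this]
  have htop : ∀ k, T.parent^[k + 1] (c^[k] u) = r (n + 1 + i) := fun k => by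
    rw [Function.iterate_succ_apply', hci, hu]
  -- The two halves of `s` are disjoint.
  have hdisj : ∀ k l, k ≤ i + 1 → s k ≠ c^[l] u := by
    intro k l hk heq
    rw [hs1 k hk] at heq
    have h1 := htop l
    rw [← heq, hri] at h1
    have h2 := hr.1 h1
    have h3 := hci l u
    rw [← heq, hri] at h3
    apply hne
    rw [← h3]
    congr 1
    omega
  have hcinj : ∀ k l, c^[k] u = c^[l] u → k = l := by
    intro k l hkl
    have h1 := htop k
    rw [hkl] at h1
    have h2 := htop l
    rw [← h1] at h2
    have := (T.h_strictMono_parent (c^[l] u)).injective (congrArg T.h h2)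
    omega
  have hray : T.G.IsRay s := by
    constructor
    · intro k l hkl
      by_cases hk : k ≤ i + 1
      · by_cases hl : l ≤ i + 1
        · rw [hs1 k hk, hs1 l hl] at hkl
          have := hr.1 hkl
          omega
        · obtain ⟨l, rfl⟩ := Nat.exists_eq_add_of_le (by omega : i + 2 ≤ l)
          rw [hs2] at hkl
          exact absurd hkl (hdisj k l hk)
      · obtain ⟨k, rfl⟩ := Nat.exists_eq_add_of_le (by omega : i + 2 ≤ k)
        by_cases hl : l ≤ i + 1
        · rw [hs2] at hkl
          exact absurd hkl.symm (hdisj l k hl)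
        · obtain ⟨l, rfl⟩ := Nat.exists_eq_add_of_le (by omega : i + 2 ≤ l)
          rw [hs2, hs2] at hkl
          rw [hcinj k l hkl]
    · intro k
      rcases lt_trichotomy k (i + 1) with hk | hk | hk
      · rw [hs1 k hk.le, hs1 (k + 1) hk]
        exact hr.2 (n + k)
      · have := hs2 0
        rw [hk, hs1 _ le_rfl, this]
        refine T.adj_iff.2 (Or.inr ?_)
        rw [Function.iterate_zero_apply, hu]
        congr 1
        omega
      · obtain ⟨k, rfl⟩ := Nat.exists_eq_add_of_le (by omega : i + 2 ≤ k)
        rw [hs2, Nat.add_assoc, hs2, Function.iterate_succ_apply']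
        exact T.adj_iff.2 (Or.inr (hc _))
  obtain ⟨a, b, hab⟩ := hn s hray (hs1 0 (by omega)) (hs1 1 (by omega))
  -- Along `r` the height increases, along the end of `s` it decreases.
  have h1 := hab (i + 2)
  have h2 := hab (i + 2 + 1)
  have h3 : T.h (r (b + (i + 2))) < T.h (r (b + (i + 2 + 1))) := hmono (by omega)
  rw [← h1, ← h2, show a + (i + 2) = i + 2 + a by omega,
    show a + (i + 2 + 1) = i + 2 + (a + 1) by omega, hs2, hs2,
    Function.iterate_succ_apply'] at h3
  have h4 := T.h_lt_parent (c (c^[a] u))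
  rw [hc] at h4
  linarith

lemma exists_top : ∃ v, 3 ≤ T.G.valence v ∧ ∀ i, T.G.valence (T.parent^[i + 1] v) < 3 := by
  obtain ⟨w, hw⟩ := T.exists_forall_valence_lt
  obtain ⟨u, hu, -⟩ := T.grand_orbit w
  obtain ⟨i, j, hij⟩ := T.exists_common_ancestor u w
  have hex : ∃ N, ∀ k, T.G.valence (T.parent^[N + k] u) < 3 :=
    ⟨i, fun k => by
      rw [Nat.add_comm, Function.iterate_add_apply, hij, ← Function.iterate_add_apply]
      exact hw _⟩
  classical
  have hspec := Nat.find_spec hex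
  have hmin := fun m => Nat.find_min hex (m := m)
  set N := Nat.find hex
  rcases Nat.eq_zero_or_pos N with h0 | hpos
  · have := hspec 0
    rw [h0] at this
    exact absurd this (by simpa using hu)
  · obtain ⟨m, hm⟩ := Nat.exists_eq_succ_of_ne_zero hpos.ne'
    have h1 := hmin m (by omega)
    push Not at h1
    obtain ⟨k, hk⟩ := h1
    refine ⟨T.parent^[m] u, ?_, fun i => ?_⟩
    · rcases Nat.eq_zero_or_pos k with rfl | hkpos
      · simpa using hk
      · have := hspec (k - 1)
        rw [show N + (k - 1) = m + k by omega] at this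
        omega
    · rw [← Function.iterate_add_apply]
      have := hspec i
      rwa [show N + i = i + 1 + m by omega] at this

/-- The highest branching vertex. -/
noncomputable def top : V := T.exists_top.choose

lemma three_le_valence_top : 3 ≤ T.G.valence T.top := T.exists_top.choose_spec.1

lemma valence_parent_top_lt (i : ℕ) : T.G.valence (T.parent^[i + 1] T.top) < 3 :=
  T.exists_top.choose_spec.2 i

/-- The trunk: the highest branching vertex and its ancestors. -/
def trunk : Set V := Set.range fun i => T.parent^[i] T.top

lemma top_mem_trunk : T.top ∈ T.trunk := ⟨0, rfl⟩

lemma eq_of_parent_eq_trunk {w : V} {i : ℕ} (hw : T.parent w = T.parent^[i + 1] T.top) :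
    w = T.parent^[i] T.top :=
  T.eq_of_parent_eq_of_valence_lt (T.valence_parent_top_lt i) hw
    (Function.iterate_succ_apply' _ _ _).symm

lemma exists_parent_iterate_mem_trunk (v : V) : ∃ j, T.parent^[j] v ∈ T.trunk := by
  obtain ⟨i, j, hij⟩ := T.exists_common_ancestor v T.top
  exact ⟨i, j, hij.symm⟩

open Classical in
/-- The depth of a vertex below the trunk. -/
noncomputable def depth (v : V) : ℕ := Nat.find (T.exists_parent_iterate_mem_trunk v)

lemma parent_depth_mem_trunk (v : V) : T.parent^[T.depth v] v ∈ T.trunk := by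
  classical
  exact Nat.find_spec (T.exists_parent_iterate_mem_trunk v)

lemma depth_le {v : V} {j : ℕ} (h : T.parent^[j] v ∈ T.trunk) : T.depth v ≤ j := by
  classical
  exact Nat.find_min' (T.exists_parent_iterate_mem_trunk v) h

lemma depth_eq_zero_iff {v : V} : T.depth v = 0 ↔ v ∈ T.trunk := by
  constructor
  · intro h
    have := T.parent_depth_mem_trunk v
    rwa [h] at this
  · intro h
    exact Nat.le_zero.1 (T.depth_le (j := 0) h)

lemma parent_depth_eq_top {v : V} (hv : 0 < T.depth v) : T.parent^[T.depth v] v = T.top := by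
  obtain ⟨i, hi⟩ := T.parent_depth_mem_trunk v
  obtain ⟨m, hm⟩ := Nat.exists_eq_succ_of_ne_zero hv.ne'
  rcases i with _ | i
  · exact hi.symm
  · have h1 : T.parent^[m] v ∈ T.trunk := by
      refine ⟨i, (T.eq_of_parent_eq_trunk ?_).symm⟩
      rw [← Function.iterate_succ_apply' T.parent, ← hm]
      exact hi.symm
    have := T.depth_le h1
    omega

lemma depth_parent_lt {v : V} (hv : 0 < T.depth v) : T.depth (T.parent v) < T.depth v := by
  obtain ⟨m, hm⟩ := Nat.exists_eq_succ_of_ne_zero hv.ne'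
  have h := T.parent_depth_mem_trunk v
  rw [hm, Function.iterate_succ_apply] at h
  have := T.depth_le h
  omega

lemma h_lt_top_of_depth_pos {v : V} (hv : 0 < T.depth v) : T.h v < T.h T.top := by
  rw [← T.parent_depth_eq_top hv]
  exact T.h_strictMono_parent v hv

lemma mem_trunk_of_h_top_le {v : V} (hv : T.h T.top ≤ T.h v) : v ∈ T.trunk := by
  rw [← T.depth_eq_zero_iff]
  by_contra h
  exact absurd (T.h_lt_top_of_depth_pos (Nat.pos_of_ne_zero h)) (not_lt.2 hv)

lemma h_top_le_of_mem_trunk {v : V} (hv : v ∈ T.trunk) : T.h T.top ≤ T.h v := by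
  obtain ⟨i, rfl⟩ := hv
  exact (T.h_strictMono_parent T.top).monotone (Nat.zero_le i)

lemma map_mem_trunk {v : V} (hv : v ∈ T.trunk) : T.F v ∈ T.trunk :=
  T.mem_trunk_of_h_top_le ((T.h_top_le_of_mem_trunk hv).trans (T.h_lt_map v).le)

lemma exists_map_top : ∃ N, T.F T.top = T.parent^[N + 1] T.top := by
  obtain ⟨N, hN⟩ := T.map_mem_trunk T.top_mem_trunk
  rcases N with _ | N
  · have := T.h_lt_map T.top
    rw [← hN] at this
    exact absurd this (lt_irrefl _)
  · exact ⟨N, hN.symm⟩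

/-- The map moves vertices towards the trunk: it commutes with `parent`, and the image of the top
lies strictly above the top, where no branches are attached. -/
lemma depth_map_lt {v : V} (hv : 0 < T.depth v) : T.depth (T.F v) < T.depth v := by
  obtain ⟨m, hm⟩ := Nat.exists_eq_succ_of_ne_zero hv.ne'
  obtain ⟨N, hN⟩ := T.exists_map_top
  have h := T.parent_depth_eq_top hv
  have h1 : T.parent^[m] (T.F v) ∈ T.trunk := by
    refine ⟨N, (T.eq_of_parent_eq_trunk ?_).symm⟩
    rw [← hN, ← h, hm, T.map_parent_iterate, Function.iterate_succ_apply']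
  have := T.depth_le h1
  omega

lemma eq_top_of_mem_trunk {v : V} (hv : v ∈ T.trunk) (h : 3 ≤ T.G.valence v) : v = T.top := by
  obtain ⟨i, rfl⟩ := hv
  rcases i with _ | i
  · rfl
  · exact absurd (T.valence_parent_top_lt i) (not_lt.2 h)

/-- Every sufficiently high vertex is an ancestor of a given one. -/
lemma exists_eq_parent_iterate (v : V) : ∃ C, ∀ w, C ≤ T.h w → ∃ i, w = T.parent^[i] v := by
  obtain ⟨j, hj⟩ := T.parent_depth_mem_trunk v
  refine ⟨T.h (T.parent^[T.depth v] v), fun w hw => ?_⟩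
  have hwt : w ∈ T.trunk := by
    apply T.mem_trunk_of_h_top_le
    exact (T.h_top_le_of_mem_trunk (T.parent_depth_mem_trunk v)).trans hw
  obtain ⟨k, rfl⟩ := hwt
  have hjk : j ≤ k := by
    rw [← hj] at hw
    exact (T.h_strictMono_parent T.top).le_iff_le.1 hw
  obtain ⟨l, rfl⟩ := Nat.exists_eq_add_of_le hjk
  refine ⟨l + T.depth v, ?_⟩
  rw [Function.iterate_add_apply, ← hj, ← Function.iterate_add_apply, Nat.add_comm]

/-! ### Local degrees and the spine -/

/-- The edge above `v` is the only edge at `v` over the edge above `F v`. -/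
lemma eq_parent_of_map_eq {v w : V} (hw : T.G.Adj v w) (h : T.F w = T.F (T.parent v)) :
    w = T.parent v := by
  refine T.eq_parent_of_adj_of_lt hw ?_
  have h1 := T.h_map w
  have h2 := T.h_map (T.parent v)
  rw [h, h2] at h1
  rw [← mul_left_cancel₀ T.d_pos.ne' h1]
  exact T.h_lt_parent v

lemma degE_parent (v : V) : T.degE s(v, T.parent v) = T.degV v := by
  rw [T.degV_eq_sum v _ (T.adj_parent v)]
  have : {u | T.G.Adj v u ∧ T.F u = T.F (T.parent v)} = {T.parent v} := by
    ext u
    simp only [Set.mem_ofPred_eq, Set.mem_singleton_iff]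
    refine ⟨fun h => T.eq_parent_of_map_eq h.1 h.2, ?_⟩
    rintro rfl
    exact ⟨T.adj_parent v, rfl⟩
  rw [this, finsum_mem_singleton]

lemma finite_nbr (v w : V) : {u | T.G.Adj v u ∧ T.F u = T.F w}.Finite :=
  (T.locallyFinite v).subset fun _ h => h.1

lemma degE_le_degV {v w : V} (hw : T.G.Adj v w) : T.degE s(v, w) ≤ T.degV v := by
  rw [T.degV_eq_sum v w hw, finsum_mem_eq_finite_toFinset_sum _ (T.finite_nbr v w)]
  exact Finset.single_le_sum (f := fun u => T.degE s(v, u)) (fun _ _ => Nat.zero_le _)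
    (by simpa using hw)

lemma degV_le_parent (v : V) : T.degV v ≤ T.degV (T.parent v) := by
  rw [← T.degE_parent v, Sym2.eq_swap]
  exact T.degE_le_degV (T.adj_parent v).symm

lemma mem_spine_iff {v : V} : v ∈ T.spine ↔ 1 < T.degV v := by
  constructor
  · rintro ⟨w, hw, h⟩
    exact h.trans_le (T.degE_le_degV hw)
  · intro h
    exact ⟨_, T.adj_parent v, by rwa [T.degE_parent]⟩

lemma parent_mem_spine {v : V} (hv : v ∈ T.spine) : T.parent v ∈ T.spine :=
  T.mem_spine_iff.2 ((T.mem_spine_iff.1 hv).trans_le (T.degV_le_parent v))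

lemma degV_eq_one {v : V} (hv : v ∉ T.spine) : T.degV v = 1 := by
  have := T.degV_pos v
  have := mt T.mem_spine_iff.2 hv
  omega

lemma degV_trunk_eq_top (i : ℕ) : T.degV (T.parent^[i] T.top) = T.degV T.top := by
  induction i with
  | zero => rfl
  | succ i ih =>
    rw [← ih]
    set w := T.parent^[i] T.top with hw
    have hp : T.parent^[i + 1] T.top = T.parent w := Function.iterate_succ_apply' _ _ _
    rw [hp, T.degV_eq_sum _ _ (T.adj_parent w).symm]
    have : {u | T.G.Adj (T.parent w) u ∧ T.F u = T.F w} = {w} := by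
      ext u
      simp only [Set.mem_ofPred_eq, Set.mem_singleton_iff]
      refine ⟨fun h => ?_, ?_⟩
      · rcases T.adj_iff.1 h.1 with h1 | h1
        · exfalso
          have h2 := T.h_map u
          rw [h.2, T.h_map, h1] at h2
          have h3 := mul_left_cancel₀ T.d_pos.ne' h2
          have := T.h_lt_parent w
          have := T.h_lt_parent (T.parent w)
          linarith
        · exact T.eq_of_parent_eq_trunk (h1.trans hp.symm)
      · intro h
        rw [h]
        exact ⟨(T.adj_parent w).symm, rfl⟩
    rw [this, finsum_mem_singleton, Sym2.eq_swap, T.degE_parent]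

lemma degV_top : T.degV T.top = T.d := by
  apply le_antisymm (T.isGreatest_d.2 ⟨_, rfl⟩)
  obtain ⟨v, hv⟩ := T.isGreatest_d.1
  obtain ⟨i, hi⟩ := T.parent_depth_mem_trunk v
  have hle : ∀ j, T.degV v ≤ T.degV (T.parent^[j] v) := by
    intro j
    induction j with
    | zero => exact le_rfl
    | succ j ih => rw [Function.iterate_succ_apply']; exact ih.trans (T.degV_le_parent _)
  rw [← hv, ← T.degV_trunk_eq_top i]
  exact (hle _).trans (le_of_eq (congrArg T.degV hi.symm))

lemma trunk_subset_spine : T.trunk ⊆ T.spine := by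
  rintro _ ⟨i, rfl⟩
  rw [T.mem_spine_iff]
  change 1 < T.degV (T.parent^[i] T.top)
  rw [T.degV_trunk_eq_top, T.degV_top]
  exact T.two_le_d

lemma depth_pos_of_notMem_spine {v : V} (hv : v ∉ T.spine) : 0 < T.depth v :=
  Nat.pos_of_ne_zero fun h => hv (T.trunk_subset_spine (T.depth_eq_zero_iff.1 h))

lemma h_le_top_of_branching {v : V} (hv : 2 < T.G.valence v) : T.h v ≤ T.h T.top := by
  rcases Nat.eq_zero_or_pos (T.depth v) with h | h
  · rw [T.eq_top_of_mem_trunk (T.depth_eq_zero_iff.1 h) hv]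
  · exact (T.h_lt_top_of_depth_pos h).le

/-- The level of a vertex only depends on its height, on `d` and on the height of the highest
branching vertex. -/
lemma level_eq (v : V) : T.level v = sInf {l : ℕ | T.h T.top ≤ (T.d : ℝ) ^ l * T.h v} := by
  unfold level
  congr 1
  ext l
  simp only [Set.mem_ofPred_eq, T.h_iterate_map]
  exact ⟨fun h => h _ T.three_le_valence_top, fun h u hu => (T.h_le_top_of_branching hu).trans h⟩

lemma weight_pos (v : V) : 0 < T.weight v := by
  unfold weight
  refine div_pos (Finset.prod_pos fun i _ => ?_) (pow_pos T.d_pos _)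
  exact_mod_cast T.degV_pos _

lemma weight_trunk {v : V} (hv : v ∈ T.trunk) : T.weight v = 1 := by
  have : T.level v = 0 := by
    rw [T.level_eq]
    exact Nat.sInf_eq_zero.2 (Or.inl (by simpa using T.h_top_le_of_mem_trunk hv))
  simp [weight, this]

lemma exists_iterate_mem_spine (v : V) : ∃ i, 0 < i ∧ T.F^[i] v ∈ T.spine := by
  obtain ⟨n, hn⟩ := pow_unbounded_of_one_lt (T.h T.top / T.h v) T.one_lt_d
  refine ⟨n + 1, Nat.succ_pos _, T.trunk_subset_spine (T.mem_trunk_of_h_top_le ?_)⟩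
  rw [Function.iterate_succ_apply']
  refine le_trans ?_ (T.h_lt_map _).le
  rw [T.h_iterate_map]
  exact ((div_lt_iff₀ (T.h_pos v)).1 hn).le

end MetrizedPolynomialTree

/-! ### Holomorphic maps between Riemann surfaces -/

section RiemannSurface

/-- Points of a Riemann surface are not isolated. -/
lemma not_eventually_eq_self {Y : Type*} [TopologicalSpace Y] [ChartedSpace ℂ Y] (y : Y) :
    ¬ ∀ᶠ y' in 𝓝 y, y' = y := by
  intro h
  set φ := chartAt ℂ y
  have hy : y ∈ φ.source := mem_chart_source ℂ y
  have h1 : ∀ᶠ z in 𝓝 (φ y), z = φ y := by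
    have hs := φ.continuousAt_symm (φ.map_source hy)
    rw [ContinuousAt, φ.left_inv hy] at hs
    filter_upwards [hs.eventually h, φ.open_target.mem_nhds (φ.map_source hy)] with z hz hzt
    rw [← hz, φ.right_inv hzt]
  have h2 : ({φ y} : Set ℂ) ∈ 𝓝 (φ y) := h1
  exact (NormedField.nhdsNE_neBot (φ y)).ne
    (by rw [nhdsWithin, ← Filter.mem_iff_inf_principal_compl]; exact h2)

lemma neBot_nhdsNE {Y : Type*} [TopologicalSpace Y] [ChartedSpace ℂ Y] (y : Y) :
    (𝓝[≠] y).NeBot := by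
  constructor
  intro h
  rw [nhdsWithin, ← Filter.mem_iff_inf_principal_compl] at h
  exact not_eventually_eq_self y h

variable {X Y : Type*} [TopologicalSpace X] [ChartedSpace ℂ X] [IsManifold 𝓘(ℂ) ω X]
  [TopologicalSpace Y] [ChartedSpace ℂ Y] [IsManifold 𝓘(ℂ) ω Y]

/-- A map between Riemann surfaces that is holomorphic near a point is analytic in charts there. -/
lemma analyticAt_chart_rep {f : Y → X} {y : Y}
    (hf : ∀ᶠ y' in 𝓝 y, MDifferentiableAt 𝓘(ℂ) 𝓘(ℂ) f y') :
    AnalyticAt ℂ (chartAt ℂ (f y) ∘ f ∘ (chartAt ℂ y).symm) (chartAt ℂ y y) := by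
  rw [Complex.analyticAt_iff_eventually_differentiableAt]
  set φ := chartAt ℂ y
  set ψ := chartAt ℂ (f y)
  have hy : y ∈ φ.source := mem_chart_source ℂ y
  have hc : ContinuousAt f y := hf.self_of_nhds.continuousAt
  have h1 : ∀ᶠ y' in 𝓝 y, MDifferentiableAt 𝓘(ℂ) 𝓘(ℂ) f y' ∧ f y' ∈ ψ.source :=
    hf.and (hc.eventually (ψ.open_source.mem_nhds (mem_chart_source ℂ (f y))))
  have hsymm : Filter.Tendsto φ.symm (𝓝 (φ y)) (𝓝 y) := by
    have := φ.continuousAt_symm (φ.map_source hy)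
    rwa [ContinuousAt, φ.left_inv hy] at this
  filter_upwards [hsymm.eventually h1, φ.open_target.mem_nhds (φ.map_source hy)] with z hz hzt
  rw [← mdifferentiableAt_iff_differentiableAt]
  have hφ := (mdifferentiable_chart (I := 𝓘(ℂ)) y).mdifferentiableAt_symm hzt
  have hψ := (mdifferentiable_chart (I := 𝓘(ℂ)) (f y)).mdifferentiableAt hz.2
  exact hψ.comp z (hz.1.comp z hφ)

/-- The local open mapping theorem on Riemann surfaces. -/
lemma nhds_le_map_of_not_eventually_const {f : Y → X} {y : Y}
    (hf : ∀ᶠ y' in 𝓝 y, MDifferentiableAt 𝓘(ℂ) 𝓘(ℂ) f y')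
    (hnc : ¬ ∀ᶠ y' in 𝓝 y, f y' = f y) : 𝓝 (f y) ≤ Filter.map f (𝓝 y) := by
  have han := analyticAt_chart_rep hf
  set φ := chartAt ℂ y
  set ψ := chartAt ℂ (f y)
  have hy : y ∈ φ.source := mem_chart_source ℂ y
  have hfy : f y ∈ ψ.source := mem_chart_source ℂ (f y)
  have hc : ContinuousAt f y := hf.self_of_nhds.continuousAt
  have hsrc : ∀ᶠ y' in 𝓝 y, f y' ∈ ψ.source := hc.eventually (ψ.open_source.mem_nhds hfy)
  have hφsrc : ∀ᶠ y' in 𝓝 y, y' ∈ φ.source := φ.open_source.mem_nhds hy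
  have hF0 : (ψ ∘ f ∘ φ.symm) (φ y) = ψ (f y) := by simp [φ.left_inv hy]
  rcases han.eventually_constant_or_nhds_le_map_nhds with h | h
  · exfalso
    apply hnc
    filter_upwards [(φ.continuousAt hy).eventually h, hsrc, hφsrc] with y' h1 h2 h3
    rw [hF0] at h1
    simp only [Function.comp_apply, φ.left_inv h3] at h1
    exact ψ.injOn h2 hfy h1
  · rw [hF0] at h
    have hmapφ : Filter.map φ.symm (𝓝 (φ y)) = 𝓝 y := by
      have := φ.symm.map_nhds_eq (x := φ y) (φ.map_source hy)
      rwa [φ.left_inv hy] at this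
    have hmapψ : Filter.map ψ.symm (𝓝 (ψ (f y))) = 𝓝 (f y) := by
      have := ψ.symm.map_nhds_eq (x := ψ (f y)) (ψ.map_source hfy)
      rwa [ψ.left_inv hfy] at this
    rw [← hmapψ]
    refine (Filter.map_mono (m := ψ.symm) h).trans ?_
    rw [← Filter.map_map, ← Filter.map_map, hmapφ, Filter.map_map]
    apply le_of_eq
    apply Filter.map_congr
    filter_upwards [hsrc] with y' h2
    exact ψ.left_inv h2

lemma MDifferentiable.isOpenMap_of_injective {f : Y → X} (hf : MDifferentiable 𝓘(ℂ) 𝓘(ℂ) f)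
    (hinj : Function.Injective f) : IsOpenMap f :=
  IsOpenMap.of_nhds_le fun y => nhds_le_map_of_not_eventually_const (.of_forall hf)
    fun h => not_eventually_eq_self y (h.mono fun _ h' => hinj h')

/-- The inverse of a bijective holomorphic map is holomorphic. It is continuous by the open
mapping theorem, holomorphic off the isolated critical values by the inverse function theorem, and
the critical values are removable singularities. -/
lemma MDifferentiable.of_rightInverse {f : Y → X} (hf : MDifferentiable 𝓘(ℂ) 𝓘(ℂ) f)
    (hinj : Function.Injective f) {g : X → Y} (hg : ∀ x, f (g x) = x) :
    MDifferentiable 𝓘(ℂ) 𝓘(ℂ) g := by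
  have hgf : ∀ y, g (f y) = y := fun y => hinj (hg _)
  have hopen := hf.isOpenMap_of_injective hinj
  have hgc : Continuous g := by
    refine continuous_def.2 fun s hs => ?_
    have : g ⁻¹' s = f '' s := by
      ext x
      exact ⟨fun hx => ⟨g x, hx, hg x⟩, fun ⟨y, hy, hyx⟩ => by
        rw [← hyx]; simpa [hgf] using hy⟩
    rw [this]
    exact hopen s hs
  intro x
  obtain ⟨y, rfl⟩ : ∃ y, f y = x := ⟨g x, hg x⟩
  have han := analyticAt_chart_rep (f := f) (y := y) (.of_forall hf)
  set φ := chartAt ℂ y with hφ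
  set ψ := chartAt ℂ (f y) with hψ
  set F : ℂ → ℂ := ψ ∘ f ∘ φ.symm with hF
  set G : ℂ → ℂ := φ ∘ g ∘ ψ.symm with hG
  have hy : y ∈ φ.source := mem_chart_source ℂ y
  have hfy : f y ∈ ψ.source := mem_chart_source ℂ (f y)
  have hsφ : Filter.Tendsto φ.symm (𝓝 (φ y)) (𝓝 y) := by
    have := φ.continuousAt_symm (φ.map_source hy)
    rwa [ContinuousAt, φ.left_inv hy] at this
  have hsψ : Filter.Tendsto ψ.symm (𝓝 (ψ (f y))) (𝓝 (f y)) := by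
    have := ψ.continuousAt_symm (ψ.map_source hfy)
    rwa [ContinuousAt, ψ.left_inv hfy] at this
  have hgt : Filter.Tendsto g (𝓝 (f y)) (𝓝 y) := by
    have := hgc.tendsto (f y)
    rwa [hgf] at this
  have hG0 : G (ψ (f y)) = φ y := by simp [hG, ψ.left_inv hfy, hgf]
  -- The points at which everything takes place in the chart domains.
  have hgood : ∀ᶠ w in 𝓝 (ψ (f y)), w ∈ ψ.target ∧ g (ψ.symm w) ∈ φ.source :=
    (show ∀ᶠ w in 𝓝 (ψ (f y)), w ∈ ψ.target from ψ.open_target.mem_nhds (ψ.map_source hfy)).and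
      ((hgt.comp hsψ).eventually (φ.open_source.mem_nhds hy))
  have hGc : ∀ w, w ∈ ψ.target ∧ g (ψ.symm w) ∈ φ.source → ContinuousAt G w := fun w hw =>
    ContinuousAt.comp (f := g ∘ ψ.symm) (φ.continuousAt hw.2)
      (ContinuousAt.comp (f := ψ.symm) hgc.continuousAt (ψ.continuousAt_symm hw.1))
  have hFG : ∀ w, w ∈ ψ.target ∧ g (ψ.symm w) ∈ φ.source → F (G w) = w := fun w hw => by
    simp [hF, hG, φ.left_inv hw.2, hg, ψ.right_inv hw.1]
  have hFnc : ¬ ∀ᶠ z in 𝓝 (φ y), F z = F (φ y) := by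
    intro h
    apply not_eventually_eq_self y
    have h1 : ∀ᶠ y' in 𝓝 y, f y' ∈ ψ.source :=
      (hf y).continuousAt.eventually (ψ.open_source.mem_nhds hfy)
    filter_upwards [(φ.continuousAt hy).eventually h, φ.open_source.mem_nhds hy, h1]
      with y' h1 h2 h3
    simp only [hF, Function.comp_apply, φ.left_inv h2, φ.left_inv hy] at h1
    exact hinj (ψ.injOn h3 hfy h1)
  have hderiv : ∀ᶠ z in 𝓝[≠] (φ y), deriv F z ≠ 0 := by
    refine han.deriv.eventually_eq_zero_or_eventually_ne_zero.resolve_left fun h => hFnc ?_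
    obtain ⟨ε, hε, hball⟩ := Metric.eventually_nhds_iff_ball.1
      (h.and (Complex.analyticAt_iff_eventually_differentiableAt.1 han))
    refine Metric.eventually_nhds_iff_ball.2 ⟨ε, hε, fun z hz => ?_⟩
    exact Metric.isOpen_ball.is_const_of_deriv_eq_zero (convex_ball _ _).isPreconnected
      (fun z hz => (hball z hz).2.differentiableWithinAt)
      (fun z hz => (hball z hz).1) hz (Metric.mem_ball_self hε)
  have hdiffF := Complex.analyticAt_iff_eventually_differentiableAt.1 han
  have hGan : AnalyticAt ℂ G (ψ (f y)) := by
    apply Complex.analyticAt_of_differentiable_on_punctured_nhds_of_continuousAt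
    · have hGt : Filter.Tendsto G (𝓝[≠] (ψ (f y))) (𝓝[≠] (φ y)) := by
        apply tendsto_nhdsWithin_of_tendsto_nhds_of_eventually_within
        · have := (hGc _ hgood.self_of_nhds)
          rw [ContinuousAt, hG0] at this
          exact this.mono_left nhdsWithin_le_nhds
        · filter_upwards [nhdsWithin_le_nhds hgood, self_mem_nhdsWithin] with w hw hne heq
          apply hne
          have h1 : F (G w) = F (φ y) := by rw [heq]
          rw [hFG w hw, ← hG0, hFG _ hgood.self_of_nhds] at h1
          exact h1
      filter_upwards [hGt.eventually hderiv, hGt.eventually (nhdsWithin_le_nhds hdiffF),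
        nhdsWithin_le_nhds hgood.eventually_nhds] with w h1 h2 h3
      exact (HasDerivAt.of_local_left_inverse (hGc w h3.self_of_nhds) h2.hasDerivAt h1
        (h3.mono fun w' hw' => hFG w' hw')).differentiableAt
    · exact hGc _ hgood.self_of_nhds
  have heq : g =ᶠ[𝓝 (f y)] φ.symm ∘ G ∘ ψ := by
    filter_upwards [ψ.open_source.mem_nhds hfy, hgt.eventually (φ.open_source.mem_nhds hy)]
      with x h1 h2
    simp [hG, ψ.left_inv h1, φ.left_inv h2]
  refine MDifferentiableAt.congr_of_eventuallyEq ?_ heq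
  have h1 := (mdifferentiable_chart (I := 𝓘(ℂ)) (f y)).mdifferentiableAt hfy
  have h2 : MDifferentiableAt 𝓘(ℂ) 𝓘(ℂ) G (ψ (f y)) :=
    mdifferentiableAt_iff_differentiableAt.2 hGan.differentiableAt
  have h3 := (mdifferentiable_chart (I := 𝓘(ℂ)) y).mdifferentiableAt_symm
    (x := G (ψ (f y))) (by rw [hG0]; exact φ.map_source hy)
  exact h3.comp (f y) (h2.comp (f y) h1)

/-- A holomorphic map from the plane with non-zero derivative has a local holomorphic inverse. -/
lemma exists_local_section {g : ℂ → X} {z₀ : ℂ}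
    (hg : ∀ᶠ z in 𝓝 z₀, MDifferentiableAt 𝓘(ℂ) 𝓘(ℂ) g z)
    (hd : mfderiv 𝓘(ℂ) 𝓘(ℂ) g z₀ (1 : ℂ) ≠ 0) :
    ∃ s : X → ℂ, s (g z₀) = z₀ ∧ MDifferentiableAt 𝓘(ℂ) 𝓘(ℂ) s (g z₀) ∧
      ∀ᶠ x in 𝓝 (g z₀), g (s x) = x := by
  have han := analyticAt_chart_rep hg
  set ψ := chartAt ℂ (g z₀) with hψ
  have hx : g z₀ ∈ ψ.source := mem_chart_source ℂ _
  have hid : (chartAt ℂ z₀ : OpenPartialHomeomorph ℂ ℂ) = OpenPartialHomeomorph.refl ℂ := rfl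
  rw [hid] at han
  change AnalyticAt ℂ (ψ ∘ g) z₀ at han
  have hψd := (mdifferentiable_chart (I := 𝓘(ℂ)) (g z₀)).mdifferentiableAt hx
  have hd' : deriv (ψ ∘ g) z₀ ≠ 0 := by
    intro h0
    apply hd
    have h1 : mfderiv 𝓘(ℂ) 𝓘(ℂ) (ψ ∘ g) z₀ (1 : ℂ) = 0 := by
      rw [mfderiv_eq_fderiv]
      exact h0
    rw [mfderiv_comp z₀ hψd hg.self_of_nhds] at h1
    exact (mdifferentiable_chart (I := 𝓘(ℂ)) (g z₀)).mfderiv_injective hx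
      (h1.trans (map_zero _).symm)
  have hstrict := han.hasStrictDerivAt
  set L := hstrict.localInverse _ _ _ hd' with hL
  have hL0 : L (ψ (g z₀)) = z₀ := (hstrict.hasStrictFDerivAt_equiv hd').localInverse_apply_image
  have hLd := hstrict.to_localInverse hd'
  have hright := (hstrict.hasStrictFDerivAt_equiv hd').eventually_right_inverse
  change ∀ᶠ w in 𝓝 (ψ (g z₀)), ψ (g (L w)) = w at hright
  have hLc : Filter.Tendsto L (𝓝 (ψ (g z₀))) (𝓝 z₀) := by
    have := hLd.hasDerivAt.continuousAt
    change Filter.Tendsto L (𝓝 (ψ (g z₀))) (𝓝 (L (ψ (g z₀)))) at this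
    rwa [hL0] at this
  refine ⟨L ∘ ψ, hL0, ?_, ?_⟩
  · exact MDifferentiableAt.comp (g z₀)
      (mdifferentiableAt_iff_differentiableAt.2 hLd.hasDerivAt.differentiableAt) hψd
  · have hψc := ψ.continuousAt hx
    filter_upwards [hψc.eventually hright, ψ.open_source.mem_nhds hx,
      (hLc.comp hψc).eventually (hg.self_of_nhds.continuousAt.eventually
        (ψ.open_source.mem_nhds hx))] with x h1 h2 h3
    exact ψ.injOn h3 h2 h1

end RiemannSurface

namespace LocalModelSurface

/-! ### Local model surfaces -/

/-- `g` is near `z₀` a parametrization of the surface by the coordinate `z` of the slit rectangle,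
in which the form is `dz` and the height is `Im z`. -/
def IsNaturalParameter (X : LocalModelSurface.{u}) (g : ℂ → X) (z₀ : ℂ) : Prop :=
  ∀ᶠ z in 𝓝 z₀, MDifferentiableAt 𝓘(ℂ) 𝓘(ℂ) g z ∧
    X.form (g z) (mfderiv 𝓘(ℂ) 𝓘(ℂ) g z (1 : ℂ)) = 1 ∧ X.height (g z) = z.im

/-- The points having a natural parametrization. They include the interiors of the strips of the
slit rectangle. -/
def naturalPoints (X : LocalModelSurface.{u}) : Set X :=
  {x | ∃ g z₀, g z₀ = x ∧ X.IsNaturalParameter g z₀}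

variable {X Y : LocalModelSurface.{u}}

lemma IsNaturalParameter.mfderiv_ne_zero {g : ℂ → X} {z₀ : ℂ} (hg : X.IsNaturalParameter g z₀) :
    mfderiv 𝓘(ℂ) 𝓘(ℂ) g z₀ (1 : ℂ) ≠ 0 := by
  intro h
  have := hg.self_of_nhds.2.1
  rw [h, map_zero] at this
  exact zero_ne_one this

lemma isOpen_naturalPoints (X : LocalModelSurface.{u}) : IsOpen X.naturalPoints := by
  rw [isOpen_iff_mem_nhds]
  rintro _ ⟨g, z₀, rfl, hg⟩
  have hle : 𝓝 (g z₀) ≤ Filter.map g (𝓝 z₀) := by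
    refine nhds_le_map_of_not_eventually_const (hg.mono fun _ h => h.1) fun hc => ?_
    apply hg.mfderiv_ne_zero
    have : g =ᶠ[𝓝 z₀] fun _ => g z₀ := hc
    rw [this.mfderiv_eq, mfderiv_const]
    rfl
  apply hle
  change ∀ᶠ z in 𝓝 z₀, g z ∈ X.naturalPoints
  filter_upwards [hg.eventually_nhds] with z hz
  exact ⟨g, z, rfl, hz⟩

lemma dense_naturalPoints (X : LocalModelSurface.{u}) : Dense X.naturalPoints := by
  obtain ⟨R⟩ := X.presentation
  rw [dense_iff_inter_open]
  rintro W hW ⟨x, hx⟩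
  set D : Set (Fin R.n × ℂ) := {p | R.a p.1.castSucc ≤ p.2.re ∧ p.2.re ≤ R.a p.1.succ ∧
      X.hmin < (p.2.im : EReal) ∧ (p.2.im : EReal) < X.hmax} with hD
  obtain ⟨⟨⟨k, z⟩, hp⟩, rfl⟩ := R.isQuotientMap.surjective x
  have hab : R.a k.castSucc < R.a k.succ := R.a_strictMono Fin.castSucc_lt_succ
  -- Points of the open strip on the horizontal segment from `z` to the middle of the strip.
  set m : ℝ := (R.a k.castSucc + R.a k.succ) / 2 with hm
  set γ : ℝ → ℂ := fun s => ⟨(1 - s) * z.re + s * m, z.im⟩ with hγ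
  have hγc : Continuous γ := by
    have : γ = fun s : ℝ => (((1 - s) * z.re + s * m : ℝ) : ℂ) + (z.im : ℂ) * Complex.I := by
      ext s; apply Complex.ext <;> simp [hγ]
    rw [this]
    fun_prop
  have hp1 : R.a k.castSucc ≤ z.re := hp.1
  have hp2 : z.re ≤ R.a k.succ := hp.2.1
  have hγD : ∀ s ∈ Set.Ioo (0 : ℝ) 1, R.a k.castSucc < (γ s).re ∧ (γ s).re < R.a k.succ := by
    rintro s ⟨h0, h1⟩
    constructor
    · simp only [hγ]; nlinarith
    · simp only [hγ]; nlinarith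
  have hcont : ContinuousOn R.P D := by
    rw [continuousOn_iff_continuous_domRestrict]; exact R.isQuotientMap.continuous
  have hmem : ∀ s ∈ Set.Ico (0 : ℝ) 1, (k, γ s) ∈ D := by
    rintro s ⟨h0, h1⟩
    rcases h0.eq_or_lt with rfl | h0
    · have : γ 0 = z := by apply Complex.ext <;> simp [hγ]
      rw [this]; exact hp
    · exact ⟨(hγD s ⟨h0, h1⟩).1.le, (hγD s ⟨h0, h1⟩).2.le, hp.2.2.1, hp.2.2.2⟩
  have hc2 : ContinuousOn (fun s => R.P (k, γ s)) (Set.Ico (0 : ℝ) 1) :=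
    hcont.comp (by fun_prop) hmem
  have hγ0 : γ 0 = z := by apply Complex.ext <;> simp [hγ]
  have hev : ∀ᶠ s in 𝓝[Set.Ico (0 : ℝ) 1] 0, R.P (k, γ s) ∈ W := by
    apply (hc2 0 (by simp)).eventually
    apply hW.mem_nhds
    simpa [hγ0] using hx
  have hev2 : ∀ᶠ s in 𝓝[>] (0 : ℝ), R.P (k, γ s) ∈ W := by
    have h1 : 𝓝[Set.Ioo (0 : ℝ) 1] 0 ≤ 𝓝[Set.Ico (0 : ℝ) 1] 0 :=
      nhdsWithin_mono _ Set.Ioo_subset_Ico_self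
    rw [nhdsWithin_Ioo_eq_nhdsGT one_pos] at h1
    exact h1 hev
  obtain ⟨s, hsW, hs⟩ := (hev2.and (Ioo_mem_nhdsGT one_pos)).exists
  refine ⟨_, hsW, fun w => R.P (k, w), γ s, rfl, ?_⟩
  have hn : ∀ᶠ w in 𝓝 (γ s), (R.a k.castSucc < w.re ∧ w.re < R.a k.succ) ∧
      X.hmin < (w.im : EReal) ∧ (w.im : EReal) < X.hmax := by
    refine (IsOpen.and ?_ ?_).mem_nhds ⟨hγD s hs, hp.2.2⟩
    · exact (isOpen_lt continuous_const Complex.continuous_re).and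
        (isOpen_lt Complex.continuous_re continuous_const)
    · have hc : Continuous fun w : ℂ => (w.im : EReal) :=
        continuous_coe_real_ereal.comp Complex.continuous_im
      exact (isOpen_lt continuous_const hc).and (isOpen_lt hc continuous_const)
  filter_upwards [hn] with w hw
  have h1 := R.holomorphic k w hw.1.1 hw.1.2 hw.2.1 hw.2.2
  exact ⟨h1.1, h1.2, R.height_eq ⟨(k, w), hw.1.1.le, hw.1.2.le, hw.2.1, hw.2.2⟩⟩

/-- The form is non-zero at natural points. -/
lemma exists_form_ne_zero {x : X} (hx : x ∈ X.naturalPoints) :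
    ∃ t : TangentSpace 𝓘(ℂ) x, X.form x t ≠ 0 := by
  obtain ⟨g, z₀, rfl, hg⟩ := hx
  exact ⟨_, by rw [hg.self_of_nhds.2.1]; exact one_ne_zero⟩

/-- A holomorphic map is open if the pullback of the form vanishes only where the form does: it is
nowhere locally constant, because the form is non-zero at the natural points, which are dense. -/
lemma isOpenMap_of_form_eq_zero {f : Y → X} (hf : MDifferentiable 𝓘(ℂ) 𝓘(ℂ) f)
    (hker : ∀ (y : Y) (t : TangentSpace 𝓘(ℂ) y),
      X.form (f y) (mfderiv 𝓘(ℂ) 𝓘(ℂ) f y t) = 0 → Y.form y t = 0) : IsOpenMap f := by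
  refine IsOpenMap.of_nhds_le fun y => nhds_le_map_of_not_eventually_const (.of_forall hf) ?_
  intro h
  obtain ⟨W, hWsub, hW, hyW⟩ := mem_nhds_iff.1 h
  obtain ⟨y', hy'W, hy'⟩ := (dense_naturalPoints Y).inter_open_nonempty W hW ⟨y, hyW⟩
  obtain ⟨t, ht⟩ := exists_form_ne_zero hy'
  apply ht
  apply hker
  have : f =ᶠ[𝓝 y'] fun _ => f y := by
    filter_upwards [hW.mem_nhds hy'W] with w hw
    exact hWsub hw
  rw [this.mfderiv_eq, mfderiv_const]
  exact map_zero _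

lemma nonempty_of_surface (X : LocalModelSurface.{u}) : Nonempty X := inferInstance

instance infinite_surface (X : LocalModelSurface.{u}) : Infinite X := by
  obtain ⟨x⟩ := X.nonempty_of_surface
  by_contra h
  rw [not_infinite_iff_finite] at h
  have := neBot_nhdsNE x
  have h2 : ({x}ᶜ : Set X).Finite := Set.toFinite _
  have h3 : {x} ∈ 𝓝 x := by
    have := h2.isClosed.isOpen_compl.mem_nhds (show x ∈ (({x}ᶜ : Set X)ᶜ) by simp)
    rwa [compl_compl] at this
  exact not_eventually_eq_self x h3

/-- A branched cover of degree one with `f^* ω = η` is a holomorphic isometry: two points with the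
same image would, by openness, give nearby non-branch points with two preimages. -/
lemma IsLocalModelMap.isHolomorphicIsometry {f : Y → X} (hf : IsLocalModelMap f 1) :
    IsHolomorphicIsometry f := by
  obtain ⟨-, hd, hproper, B, hB, -, hcard⟩ := hf.isBranchedCover
  have hpull : ∀ (y : Y) (t : TangentSpace 𝓘(ℂ) y),
      X.form (f y) (mfderiv 𝓘(ℂ) 𝓘(ℂ) f y t) = Y.form y t := fun y t => by
    have := hf.pullback y t
    simpa using this.symm
  have hopen : IsOpenMap f := isOpenMap_of_form_eq_zero hd fun y t h => by rw [← hpull, h]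
  have hnb : ∀ x : X, (𝓝[≠] x).NeBot := fun x => neBot_nhdsNE x
  refine ⟨⟨?_, ?_⟩, hd, fun y t => by rw [hpull]⟩
  · intro y₁ y₂ h12
    by_contra hne
    obtain ⟨W₁, W₂, hW₁, hW₂, hy₁, hy₂, hdisj⟩ := t2_separation hne
    have hO : IsOpen (f '' W₁ ∩ f '' W₂) := (hopen _ hW₁).inter (hopen _ hW₂)
    have hdense : Dense ((Set.univ : Set X) \ B) := dense_univ.sdiff_finite hB
    obtain ⟨x, ⟨⟨a, ha, hax⟩, b, hb, hbx⟩, -, hxB⟩ :=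
      hdense.inter_open_nonempty _ hO ⟨f y₁, ⟨y₁, hy₁, rfl⟩, y₂, hy₂, h12.symm⟩
    obtain ⟨c, hc⟩ := Set.ncard_eq_one.1 (hcard x hxB)
    have hac : a = c := by
      have : a ∈ f ⁻¹' {x} := hax
      rwa [hc] at this
    have hbc : b = c := by
      have : b ∈ f ⁻¹' {x} := hbx
      rwa [hc] at this
    exact Set.disjoint_left.1 hdisj ha (by rw [hac, ← hbc]; exact hb)
  · rw [← Set.range_eq_univ]
    exact IsClopen.eq_univ ⟨hproper.isClosedMap.isClosed_range, hopen.isOpen_range⟩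
      (Set.range_nonempty f)

/-- Conjugate branched covers have the same degree. -/
lemma IsBranchedCover.degree_eq {X₁ X₂ Y₁ Y₂ : LocalModelSurface.{u}} {f₁ : Y₁ → X₁} {f₂ : Y₂ → X₂}
    {k₁ k₂ : ℕ} (h₁ : IsBranchedCover f₁ k₁) (h₂ : IsBranchedCover f₂ k₂)
    {i : Y₁ → Y₂} {j : X₁ → X₂}
    (hi : Function.Bijective i) (hj : Function.Bijective j) (h : ∀ y, j (f₁ y) = f₂ (i y)) :
    k₁ = k₂ := by
  obtain ⟨-, -, -, B₁, hB₁, -, hc₁⟩ := h₁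
  obtain ⟨-, -, -, B₂, hB₂, -, hc₂⟩ := h₂
  obtain ⟨x, hx⟩ := (hB₁.union (hB₂.preimage (f := j) hj.1.injOn)).exists_notMem
  simp only [Set.mem_union, not_or] at hx
  rw [← hc₁ x hx.1, ← hc₂ (j x) hx.2, ← Set.ncard_image_of_injective _ hi.1]
  congr 1
  ext y
  constructor
  · rintro ⟨y', hy', rfl⟩
    have : f₁ y' = x := hy'
    change f₂ (i y') = j x
    rw [← h, this]
  · intro hy
    obtain ⟨y', rfl⟩ := hi.2 y
    refine ⟨y', hj.1 ?_, rfl⟩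
    rw [h]
    exact hy

lemma IsHolomorphicIsometry.isOpenMap {f : Y → X} (hf : IsHolomorphicIsometry f) : IsOpenMap f :=
  hf.holomorphic.isOpenMap_of_injective hf.bijective.1

lemma IsHolomorphicIsometry.continuous {f : Y → X} (hf : IsHolomorphicIsometry f) : Continuous f :=
  hf.holomorphic.continuous

lemma IsHolomorphicIsometry.comp {Z : LocalModelSurface.{u}} {f : Y → X} {g : Z → Y}
    (hf : IsHolomorphicIsometry f) (hg : IsHolomorphicIsometry g) :
    IsHolomorphicIsometry (f ∘ g) := by
  refine ⟨hf.bijective.comp hg.bijective, hf.holomorphic.comp hg.holomorphic, fun z t => ?_⟩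
  rw [mfderiv_comp z (hf.holomorphic _) (hg.holomorphic _)]
  exact (hf.isometry _ _).trans (hg.isometry z t)

/-- If `f ∘ g` and `f` are holomorphic isometries, then so is `g`. -/
lemma IsHolomorphicIsometry.of_comp {Z : LocalModelSurface.{u}} {f : Y → X} {g : Z → Y}
    (hf : IsHolomorphicIsometry f) (hfg : IsHolomorphicIsometry (f ∘ g)) :
    IsHolomorphicIsometry g := by
  have hr := Function.rightInverse_surjInv hf.bijective.2
  have hs := hf.holomorphic.of_rightInverse hf.bijective.1 hr
  have hg : MDifferentiable 𝓘(ℂ) 𝓘(ℂ) g := by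
    have : g = Function.surjInv hf.bijective.2 ∘ (f ∘ g) := by
      funext z
      exact hf.bijective.1 (hr (f (g z))).symm
    rw [this]
    exact hs.comp hfg.holomorphic
  refine ⟨hf.bijective.of_comp_iff' _ |>.1 hfg.bijective, hg, fun z t => ?_⟩
  rw [← hf.isometry, ← hfg.isometry, mfderiv_comp z (hf.holomorphic _) (hg _)]
  rfl

/-- If a holomorphic isometry changes heights on some open set by an increasing affine map, this map
is a translation. In natural parameters the isometry is a holomorphic function `θ` with `|θ'| = 1`
and `Im θ = a + b Im z`; the last equation gives `θ' = b`. -/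
lemma IsHolomorphicIsometry.slope_eq_one {j : Y → X} (hj : IsHolomorphicIsometry j) {W : Set Y}
    (hW : IsOpen W) (hne : W.Nonempty) {a b : ℝ} (hb : 0 < b)
    (h : ∀ y ∈ W, X.height (j y) = a + b * Y.height y) : b = 1 := by
  -- A natural point of `W` with natural image.
  have hO : IsOpen (W ∩ Y.naturalPoints) := hW.inter Y.isOpen_naturalPoints
  have hOne : (W ∩ Y.naturalPoints).Nonempty := Y.dense_naturalPoints.inter_open_nonempty W hW hne
  obtain ⟨x, ⟨_, ⟨hyW, g, z₀, rfl, hg⟩, rfl⟩, g', w₀, hw₀, hg'⟩ :=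
    X.dense_naturalPoints.inter_open_nonempty (j '' (W ∩ Y.naturalPoints)) (hj.isOpenMap _ hO)
      (hOne.image j)
  obtain ⟨s, hs0, hsd, hsr⟩ := exists_local_section (hg'.mono fun _ h => h.1) hg'.mfderiv_ne_zero
  rw [hw₀] at hs0 hsd hsr
  have hgd := hg.self_of_nhds.1
  have hjd := hj.holomorphic (g z₀)
  set θ : ℂ → ℂ := s ∘ j ∘ g with hθ
  have hjg : MDifferentiableAt 𝓘(ℂ) 𝓘(ℂ) (j ∘ g) z₀ := hjd.comp z₀ hgd
  have hθd : MDifferentiableAt 𝓘(ℂ) 𝓘(ℂ) θ z₀ := hsd.comp z₀ hjg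
  have hθ0 : θ z₀ = w₀ := hs0
  have heq : g' ∘ θ =ᶠ[𝓝 z₀] j ∘ g := hjg.continuousAt.eventually hsr
  have hdiff : DifferentiableAt ℂ θ z₀ := mdifferentiableAt_iff_differentiableAt.1 hθd
  set c := deriv θ z₀ with hc
  have hcd : HasDerivAt θ c z₀ := hdiff.hasDerivAt
  -- The derivative of `θ` has absolute value one.
  have hnorm : ‖c‖ = 1 := by
    have h1 := heq.mfderiv_eq (I := 𝓘(ℂ)) (I' := 𝓘(ℂ))
    have hg'd : MDifferentiableAt 𝓘(ℂ) 𝓘(ℂ) g' (θ z₀) := by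
      rw [hθ0]; exact hg'.self_of_nhds.1
    rw [mfderiv_comp z₀ hg'd hθd, mfderiv_comp z₀ hjd hgd] at h1
    have h2 := hj.isometry (g z₀) (mfderiv 𝓘(ℂ) 𝓘(ℂ) g z₀ (1 : ℂ))
    rw [hg.self_of_nhds.2.1, norm_one] at h2
    have h3 : mfderiv 𝓘(ℂ) 𝓘(ℂ) θ z₀ (1 : ℂ) = c • (1 : ℂ) := by
      rw [mfderiv_eq_fderiv]
      change fderiv ℂ θ z₀ 1 = _
      rw [hcd.hasFDerivAt.fderiv]
      simp
    have h4 : mfderiv 𝓘(ℂ) 𝓘(ℂ) j (g z₀) (mfderiv 𝓘(ℂ) 𝓘(ℂ) g z₀ (1 : ℂ)) =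
        c • mfderiv 𝓘(ℂ) 𝓘(ℂ) g' (θ z₀) (1 : ℂ) := by
      have := DFunLike.congr_fun h1 (1 : ℂ)
      refine Eq.trans this.symm ?_
      change mfderiv 𝓘(ℂ) 𝓘(ℂ) g' (θ z₀) (mfderiv 𝓘(ℂ) 𝓘(ℂ) θ z₀ (1 : ℂ)) = _
      rw [h3]
      exact map_smul (mfderiv 𝓘(ℂ) 𝓘(ℂ) g' (θ z₀)) c (1 : ℂ)
    have h5 : X.form (g' (θ z₀)) (mfderiv 𝓘(ℂ) 𝓘(ℂ) g' (θ z₀) (1 : ℂ)) = 1 := by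
      rw [hθ0]; exact hg'.self_of_nhds.2.1
    have h6 : g' (θ z₀) = j (g z₀) := heq.self_of_nhds
    have h7 : X.form (j (g z₀)) (c • mfderiv 𝓘(ℂ) 𝓘(ℂ) g' (θ z₀) (1 : ℂ)) = c := by
      rw [← h6]
      exact (map_smul (X.form (g' (θ z₀))) c _).trans (by rw [h5]; simp)
    rw [h4, h7] at h2
    exact h2
  -- The imaginary part of `θ` is an affine function of the height.
  have him : ∀ᶠ z in 𝓝 z₀, (θ z).im = a + b * z.im := by
    have h1 : ∀ᶠ z in 𝓝 z₀, X.height (g' (θ z)) = (θ z).im := by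
      have := hθd.continuousAt
      rw [ContinuousAt, hθ0] at this
      exact this.eventually (hg'.mono fun _ h => h.2.2)
    filter_upwards [h1, heq, hgd.continuousAt.eventually (hW.mem_nhds hyW), hg] with z h1 h2 h3 h4
    rw [← h1, ← h4.2.2, ← h _ h3]
    exact congrArg X.height h2
  have hline : ∀ t : ℂ, (c * t).im = b * t.im := by
    intro t
    have hl : HasDerivAt (fun r : ℝ => z₀ + (r : ℂ) * t) t 0 := by
      simpa using ((Complex.ofRealCLM.hasDerivAt (x := 0)).mul_const t).const_add z₀
    have hcd' : HasDerivAt θ c (z₀ + ((0 : ℝ) : ℂ) * t) := by simpa using hcd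
    have h1 : HasDerivAt (fun r : ℝ => θ (z₀ + (r : ℂ) * t)) (c * t) 0 := hcd'.comp (0 : ℝ) hl
    have h2 : HasDerivAt (fun r : ℝ => (θ (z₀ + (r : ℂ) * t)).im) (c * t).im 0 := by
      exact Complex.imCLM.hasFDerivAt.comp_hasDerivAt (0 : ℝ) h1
    have h3 : HasDerivAt (fun r : ℝ => a + b * (z₀.im + r * t.im)) (b * t.im) 0 := by
      simpa using
        ((((hasDerivAt_id (0 : ℝ)).mul_const t.im).const_add z₀.im).const_mul b).const_add a
    refine h2.unique (h3.congr_of_eventuallyEq ?_)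
    have h4 : Filter.Tendsto (fun r : ℝ => z₀ + (r : ℂ) * t) (𝓝 0) (𝓝 z₀) := by
      have := hl.continuousAt
      simpa [ContinuousAt] using this
    filter_upwards [h4.eventually him] with r hr
    rw [hr]
    simp
  have h1 := hline 1
  have h2 := hline Complex.I
  simp at h1 h2
  have h3 : c = (b : ℂ) := by apply Complex.ext <;> simp [h1, h2]
  rw [h3, Complex.norm_real, Real.norm_eq_abs, abs_of_pos hb] at hnorm
  exact hnorm

end LocalModelSurface

/-! ### Points of the star of a vertex -/

section PushPoint

variable {V W : Type*} {φ : V → W} {p : V → ℝ} {v u : V}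

lemma pushPoint_apply_map (hne : φ u ≠ φ v) (h : ∀ w, w ≠ v → w ≠ u → p w = 0) :
    pushPoint φ p (φ v) = p v := by
  unfold pushPoint
  rw [finsum_eq_single _ v]
  · simp
  · intro w hw
    by_cases hwu : w = u
    · subst hwu
      simp [hne]
    · rw [h w hw hwu]
      simp

lemma pushPoint_apply_of_injective (hφ : Function.Injective φ) (v : V) :
    pushPoint φ p (φ v) = p v := by
  have : φ ⁻¹' {φ v} = {v} := by
    ext w
    simp [hφ.eq_iff]
  unfold pushPoint
  rw [this, finsum_mem_singleton]

end PushPoint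

namespace MetrizedPolynomialTree

variable {V : Type*} (T : MetrizedPolynomialTree V)

variable {T} in
/-- A point of the star of `v` lies on a closed edge at `v`. -/
lemma exists_of_mem_star {v : V} {p : V → ℝ} (hp : p ∈ T.star v) :
    ∃ u, T.G.Adj v u ∧ p v + p u = 1 ∧ ∀ w, w ≠ v → w ≠ u → p w = 0 := by
  obtain ⟨⟨-, a, b, hab, hsum, h0⟩, hv⟩ := hp
  by_cases ha : v = a
  · subst ha
    exact ⟨b, hab, hsum, h0⟩
  · by_cases hb : v = b
    · subst hb
      exact ⟨a, hab.symm, by rw [add_comm]; exact hsum, fun w h1 h2 => h0 w h2 h1⟩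
    · rw [h0 v ha hb] at hv
      exact absurd hv (lt_irrefl _)

variable {T} in
lemma of_mem_star_of_pos {v u : V} {p : V → ℝ} (hp : p ∈ T.star v) (hu : u ≠ v) (hpos : 0 < p u) :
    T.G.Adj v u ∧ p v + p u = 1 ∧ ∀ w, w ≠ v → w ≠ u → p w = 0 := by
  obtain ⟨w, hw⟩ := T.exists_of_mem_star hp
  by_cases h : u = w
  · subst h; exact hw
  · rw [hw.2.2 u hu h] at hpos
    exact absurd hpos (lt_irrefl _)

lemma heightAt_eq {v u : V} {p : V → ℝ} (hne : v ≠ u) (h : ∀ w, w ≠ v → w ≠ u → p w = 0) :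
    T.heightAt p = p v * T.h v + p u * T.h u := by
  classical
  unfold heightAt
  rw [finsum_eq_sum_of_support_subset (s := {v, u})]
  · rw [Finset.sum_pair hne]
  · intro w hw
    by_contra hcon
    simp only [Finset.coe_insert, Finset.coe_singleton, Set.mem_insert_iff,
      Set.mem_singleton_iff, not_or] at hcon
    exact hw (by simp [h w hcon.1 hcon.2])

/-- The open edge from `v` to `u`, as a part of the star of `v`. -/
def openEdge (v u : V) : Set (T.star v) := {p | 0 < p.1 u}

lemma isOpen_openEdge (v u : V) : IsOpen (T.openEdge v u) :=
  isOpen_lt continuous_const ((continuous_apply u).comp continuous_subtype_val)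

open Classical in
/-- The point of the edge from `v` to `u` at the fraction `t` of its length. -/
noncomputable def edgePoint (v u : V) (t : ℝ) : V → ℝ :=
  fun w => if w = v then 1 - t else if w = u then t else 0

lemma edgePoint_mem_star {v u : V} (hu : T.G.Adj v u) {t : ℝ} (ht : t ∈ Set.Ioo (0 : ℝ) 1) :
    edgePoint v u t ∈ T.star v := by
  have hne := hu.ne'
  refine ⟨⟨fun w => ?_, v, u, hu, ?_, fun w h1 h2 => ?_⟩, ?_⟩
  · unfold edgePoint
    split_ifs
    · linarith [ht.2]
    · exact ht.1.le
    · exact le_rfl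
  · simp [edgePoint, hne]
  · simp [edgePoint, h1, h2]
  · simp only [edgePoint, if_true]
    linarith [ht.2]

lemma isConnected_openEdge {v u : V} (hu : T.G.Adj v u) : IsConnected (T.openEdge v u) := by
  have hcont : Continuous fun t : Set.Ioo (0 : ℝ) 1 =>
      (⟨edgePoint v u t, T.edgePoint_mem_star hu t.2⟩ : T.star v) := by
    refine Continuous.subtype_mk (continuous_pi fun w => ?_) _
    unfold edgePoint
    split_ifs <;> fun_prop
  have hrange : T.openEdge v u = Set.range fun t : Set.Ioo (0 : ℝ) 1 =>
      (⟨edgePoint v u t, T.edgePoint_mem_star hu t.2⟩ : T.star v) := by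
    ext ⟨p, hp⟩
    constructor
    · intro hpu
      obtain ⟨-, hsum, h0⟩ := T.of_mem_star_of_pos hp hu.ne' hpu
      have hpv : 0 < p v := hp.2
      have hpu' : 0 < p u := hpu
      refine ⟨⟨p u, hpu', by linarith⟩, Subtype.ext ?_⟩
      funext w
      simp only [edgePoint]
      split_ifs with h1 h2
      · rw [h1]; linarith
      · rw [h2]
      · exact (h0 w h1 h2).symm
    · rintro ⟨t, ht⟩
      have : p u = t := by
        have h := congrArg (fun q : T.star v => q.1 u) ht
        simpa [edgePoint, hu.ne'] using h.symm
      change 0 < p u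
      rw [this]
      exact t.2.1
  rw [hrange]
  have : ConnectedSpace (Set.Ioo (0 : ℝ) 1) :=
    isConnected_iff_connectedSpace.1 (isConnected_Ioo one_pos)
  exact isConnected_range hcont

end MetrizedPolynomialTree

namespace TreeOfLocalModels

/-! ### The annuli of a local model surface -/

variable {V : Type*} {T : MetrizedPolynomialTree V} (M : TreeOfLocalModels.{u} T)

/-- The annulus of `X_v` over the open edge from `v` to a neighbour `u`. -/
def annulus (v u : V) : Set (M.surf v) := {x | 0 < (M.mark v x : V → ℝ) u}

lemma isOpen_annulus (v u : V) : IsOpen (M.annulus v u) :=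
  (T.isOpen_openEdge v u).preimage (M.mark_isQuotientMap v).continuous

lemma nonempty_annulus {v u : V} (hu : T.G.Adj v u) : (M.annulus v u).Nonempty := by
  obtain ⟨p, hp⟩ := (T.isConnected_openEdge hu).nonempty
  obtain ⟨x, rfl⟩ := (M.mark_isQuotientMap v).surjective p
  exact ⟨x, hp⟩

/-- The annulus is the preimage of a connected set under a quotient map with connected fibres, the
leaves. -/
lemma isConnected_annulus {v u : V} (hu : T.G.Adj v u) : IsConnected (M.annulus v u) := by
  set O := T.openEdge v u with hO
  have hq := (M.mark_isQuotientMap v).restrictPreimage_isOpen (T.isOpen_openEdge v u)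
  have hfib : ∀ p : O, IsConnected (O.restrictPreimage (M.mark v) ⁻¹' {p}) := by
    rintro ⟨p, hp⟩
    obtain ⟨x, rfl⟩ := (M.mark_isQuotientMap v).surjective p
    have hleaf : IsConnected ((M.surf v).leaf x) :=
      isConnected_connectedComponentIn_iff.2 (by simp)
    have himg : (Subtype.val : M.mark v ⁻¹' O → M.surf v) ''
        (O.restrictPreimage (M.mark v) ⁻¹' {⟨M.mark v x, hp⟩}) = (M.surf v).leaf x := by
      ext y
      constructor
      · rintro ⟨⟨y, hy⟩, hyx, rfl⟩
        exact (M.mark_eq_iff v x y).1 (congrArg Subtype.val hyx).symm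
      · intro hy
        have hxy := (M.mark_eq_iff v x y).2 hy
        exact ⟨⟨y, by change M.mark v y ∈ O; rw [← hxy]; exact hp⟩, Subtype.ext hxy.symm, rfl⟩
    rw [← himg] at hleaf
    refine ⟨hleaf.nonempty.of_image, ?_⟩
    exact Topology.IsInducing.subtypeVal.isPreconnected_image.1 hleaf.isPreconnected
  have huniv : IsConnected (Set.univ : Set O) := by
    have := isConnected_iff_connectedSpace.1 (T.isConnected_openEdge hu)
    exact isConnected_univ
  have := hq.isCoinducing.isConnected_preimage_of_isClosed hfib isClosed_univ huniv
  have h2 := this.image Subtype.val continuous_subtype_val.continuousOn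
  rw [Set.preimage_univ, Set.image_univ, Subtype.range_coe] at h2
  exact h2

lemma eq_of_mem_annulus {v u w : V} {x : M.surf v} (hu : u ≠ v) (hw : w ≠ v)
    (hxu : x ∈ M.annulus v u) (hxw : x ∈ M.annulus v w) : u = w := by
  by_contra hne
  have h0 := (T.of_mem_star_of_pos (M.mark v x).2 hu hxu).2.2 w hw (Ne.symm hne)
  have : 0 < (M.mark v x : V → ℝ) w := hxw
  rw [h0] at this
  exact lt_irrefl _ this

lemma mark_add_mark {v u : V} (hu : u ≠ v) {x : M.surf v} (hx : x ∈ M.annulus v u) :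
    (M.mark v x : V → ℝ) v + (M.mark v x : V → ℝ) u = 1 :=
  (T.of_mem_star_of_pos (M.mark v x).2 hu hx).2.1

lemma exists_mem_annulus {v : V} {x : M.surf v} (hx : (M.mark v x : V → ℝ) v < 1) :
    ∃ u, T.G.Adj v u ∧ x ∈ M.annulus v u := by
  obtain ⟨u, hu, hsum, -⟩ := T.exists_of_mem_star (M.mark v x).2
  exact ⟨u, hu, by change 0 < (M.mark v x : V → ℝ) u; linarith⟩

lemma mark_self_lt_one {v u : V} (hu : u ≠ v) {x : M.surf v} (hx : x ∈ M.annulus v u) :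
    (M.mark v x : V → ℝ) v < 1 := by
  have h1 := M.mark_add_mark hu hx
  have h2 : 0 < (M.mark v x : V → ℝ) u := hx
  linarith

/-- The local model maps preserve the barycentric coordinate of the central vertex. -/
lemma mark_map_self (v : V) (x : M.surf v) :
    (M.mark (T.F v) (M.map v x) : V → ℝ) (T.F v) = (M.mark v x : V → ℝ) v := by
  obtain ⟨u, hu, -, h0⟩ := T.exists_of_mem_star (M.mark v x).2
  rw [M.mark_map]
  exact pushPoint_apply_map (T.map_adj hu).ne' h0

/-- The local model maps send annuli to annuli. -/
lemma map_mem_annulus {v u : V} (hu : T.G.Adj v u) {x : M.surf v} (hx : x ∈ M.annulus v u) :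
    M.map v x ∈ M.annulus (T.F v) (T.F u) := by
  obtain ⟨-, -, h0⟩ := T.of_mem_star_of_pos (M.mark v x).2 hu.ne' hx
  change 0 < (M.mark (T.F v) (M.map v x) : V → ℝ) (T.F u)
  rw [M.mark_map, pushPoint_apply_map (u := v) (T.map_adj hu).ne fun w h1 h2 => h0 w h2 h1]
  exact hx

lemma height_annulus {v u : V} (hu : u ≠ v) {x : M.surf v} (hx : x ∈ M.annulus v u) :
    T.weight v * ((M.surf v).c0 - (M.surf v).height x) =
      (1 - (M.mark v x : V → ℝ) v) * (T.h v - T.h u) := by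
  obtain ⟨-, hsum, h0⟩ := T.of_mem_star_of_pos (M.mark v x).2 hu hx
  have h1 := M.mark_height v x
  rw [T.heightAt_eq hu.symm h0] at h1
  have h2 : (M.mark v x : V → ℝ) u = 1 - (M.mark v x : V → ℝ) v := by linarith
  rw [h2] at h1
  linarith

lemma isHolomorphicIsometry_map {v : V} (hv : T.degV v = 1) : IsHolomorphicIsometry (M.map v) := by
  have := M.isLocalModelMap v
  rw [hv] at this
  exact this.isHolomorphicIsometry

end TreeOfLocalModels

/-! ### Isometries between local model surfaces of two trees -/

section Pair

open TreeOfLocalModels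

variable {V₁ V₂ : Type*} {T₁ : MetrizedPolynomialTree V₁} {T₂ : MetrizedPolynomialTree V₂}
  {M₁ : TreeOfLocalModels.{u} T₁} {M₂ : TreeOfLocalModels.{u} T₂}

/-- A holomorphic isometry between local model surfaces, compatible with the markings as far as the
barycentric coordinates of the central vertices are concerned. Such an isometry maps annuli
onto annuli. -/
structure IsMarkedIsometry (M₁ : TreeOfLocalModels.{u} T₁) (M₂ : TreeOfLocalModels.{u} T₂)
    {v : V₁} {v' : V₂} (j : M₁.surf v → M₂.surf v') : Prop where
  isHolomorphicIsometry : IsHolomorphicIsometry j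
  mark_self : ∀ x, (M₂.mark v' (j x) : V₂ → ℝ) v' = (M₁.mark v x : V₁ → ℝ) v

namespace IsMarkedIsometry

variable {v : V₁} {v' : V₂} {j : M₁.surf v → M₂.surf v'}

lemma exists_mapsTo (hj : IsMarkedIsometry M₁ M₂ j) {u : V₁} (hu : T₁.G.Adj v u) :
    ∃ u', T₂.G.Adj v' u' ∧ Set.MapsTo j (M₁.annulus v u) (M₂.annulus v' u') := by
  have hex : ∀ x ∈ M₁.annulus v u, ∃ u', T₂.G.Adj v' u' ∧ j x ∈ M₂.annulus v' u' := fun x hx =>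
    M₂.exists_mem_annulus (by rw [hj.mark_self]; exact M₁.mark_self_lt_one hu.ne' hx)
  obtain ⟨x₀, hx₀⟩ := M₁.nonempty_annulus hu
  obtain ⟨u', hu', hxu'⟩ := hex x₀ hx₀
  refine ⟨u', hu', ?_⟩
  have hc := hj.isHolomorphicIsometry.continuous
  have hO₁ : IsOpen (j ⁻¹' M₂.annulus v' u') := (M₂.isOpen_annulus v' u').preimage hc
  have hO₂ : IsOpen (⋃ w ∈ {w | T₂.G.Adj v' w ∧ w ≠ u'}, j ⁻¹' M₂.annulus v' w) :=
    isOpen_biUnion fun w _ => (M₂.isOpen_annulus v' w).preimage hc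
  refine (M₁.isConnected_annulus hu).isPreconnected.subset_left_of_subset_union hO₁ hO₂ ?_ ?_
    ⟨x₀, hx₀, hxu'⟩
  · refine Set.disjoint_left.2 fun x hx hx' => ?_
    simp only [Set.mem_iUnion] at hx'
    obtain ⟨w, hw, hxw⟩ := hx'
    exact hw.2 (M₂.eq_of_mem_annulus hw.1.ne' hu'.ne' hxw hx)
  · intro x hx
    obtain ⟨w, hw, hxw⟩ := hex x hx
    by_cases h : w = u'
    · left; rw [← h]; exact hxw
    · right
      simp only [Set.mem_iUnion]
      exact ⟨w, ⟨hw, h⟩, hxw⟩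

lemma eq_of_mapsTo (hj : IsMarkedIsometry M₁ M₂ j) {u w : V₁} {u' : V₂}
    (hu : T₁.G.Adj v u) (hw : T₁.G.Adj v w)
    (hu' : T₂.G.Adj v' u') (h1 : Set.MapsTo j (M₁.annulus v u) (M₂.annulus v' u'))
    (h2 : Set.MapsTo j (M₁.annulus v w) (M₂.annulus v' u')) : u = w := by
  have hb := hj.isHolomorphicIsometry.bijective
  have ho := hj.isHolomorphicIsometry.isOpenMap
  -- The image of the annulus of `u` is relatively clopen in the annulus of `u'`.
  have hO₁ : IsOpen (j '' M₁.annulus v u) := ho _ (M₁.isOpen_annulus v u)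
  have hO₂ : IsOpen (j '' ⋃ w ∈ {w | T₁.G.Adj v w ∧ w ≠ u}, M₁.annulus v w) :=
    ho _ (isOpen_biUnion fun w _ => M₁.isOpen_annulus v w)
  have hdisj : Disjoint (j '' M₁.annulus v u)
      (j '' ⋃ w ∈ {w | T₁.G.Adj v w ∧ w ≠ u}, M₁.annulus v w) := by
    rw [Set.disjoint_image_iff hb.1, Set.disjoint_left]
    intro x hx hx'
    simp only [Set.mem_iUnion] at hx'
    obtain ⟨w, hw, hxw⟩ := hx'
    exact hw.2 (M₁.eq_of_mem_annulus hw.1.ne' hu.ne' hxw hx)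
  obtain ⟨x, hx⟩ := M₁.nonempty_annulus hu
  have hsub := (M₂.isConnected_annulus hu').isPreconnected.subset_left_of_subset_union hO₁ hO₂ hdisj
    (by
      intro y hy
      obtain ⟨x, rfl⟩ := hb.2 y
      obtain ⟨w, hw, hxw⟩ := M₁.exists_mem_annulus (x := x) (v := v)
        (by rw [← hj.mark_self]; exact M₂.mark_self_lt_one hu'.ne' hy)
      by_cases h : w = u
      · left; exact ⟨x, h ▸ hxw, rfl⟩
      · right
        refine ⟨x, ?_, rfl⟩
        simp only [Set.mem_iUnion]
        exact ⟨w, ⟨hw, h⟩, hxw⟩)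
    ⟨j x, h1 hx, x, hx, rfl⟩
  obtain ⟨y, hy⟩ := M₁.nonempty_annulus hw
  obtain ⟨z, hz, hzy⟩ := hsub (h2 hy)
  rw [hb.1 hzy] at hz
  exact M₁.eq_of_mem_annulus hu.ne' hw.ne' hz hy

lemma exists_mapsTo_of_adj (hj : IsMarkedIsometry M₁ M₂ j) {u' : V₂} (hu' : T₂.G.Adj v' u') :
    ∃ u, T₁.G.Adj v u ∧ Set.MapsTo j (M₁.annulus v u) (M₂.annulus v' u') := by
  obtain ⟨y, hy⟩ := M₂.nonempty_annulus hu'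
  obtain ⟨x, rfl⟩ := hj.isHolomorphicIsometry.bijective.2 y
  obtain ⟨u, hu, hxu⟩ := M₁.exists_mem_annulus (x := x) (v := v)
    (by rw [← hj.mark_self]; exact M₂.mark_self_lt_one hu'.ne' hy)
  obtain ⟨w, hw, hmap⟩ := hj.exists_mapsTo hu
  rw [M₂.eq_of_mem_annulus hw.ne' hu'.ne' (hmap hxu) hy] at hmap
  exact ⟨u, hu, hmap⟩

lemma valence_eq (hj : IsMarkedIsometry M₁ M₂ j) : T₁.G.valence v = T₂.G.valence v' := by
  have hex : ∀ u : T₁.G.neighborSet v, ∃ u' : T₂.G.neighborSet v',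
      Set.MapsTo j (M₁.annulus v u) (M₂.annulus v' u') := fun u => by
    obtain ⟨u', hu', h⟩ := hj.exists_mapsTo u.2
    exact ⟨⟨u', hu'⟩, h⟩
  choose τ hτ using hex
  have hbij : Function.Bijective τ := by
    constructor
    · intro u w h
      exact Subtype.ext (hj.eq_of_mapsTo u.2 w.2 (τ w).2 (h ▸ hτ u) (hτ w))
    · intro u'
      obtain ⟨u, hu, h⟩ := hj.exists_mapsTo_of_adj u'.2
      refine ⟨⟨u, hu⟩, Subtype.ext ?_⟩
      obtain ⟨x, hx⟩ := M₁.nonempty_annulus hu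
      exact M₂.eq_of_mem_annulus (τ ⟨u, hu⟩).2.ne' u'.2.ne' (hτ ⟨u, hu⟩ hx) (h hx)
  unfold SimpleGraph.valence
  rw [← Nat.card_coe_set_eq, ← Nat.card_coe_set_eq]
  exact Nat.card_congr (Equiv.ofBijective τ hbij)

/-- Corresponding edges have lengths proportional to the weights. In the coordinates of
the local models, both heights are affine functions of the barycentric coordinate, and an
isometry cannot change their slope. -/
lemma edge_length (hj : IsMarkedIsometry M₁ M₂ j) {u : V₁} {u' : V₂}
    (hu : T₁.parent u = v) (hu' : T₂.parent u' = v')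
    (hmap : Set.MapsTo j (M₁.annulus v u) (M₂.annulus v' u')) :
    (T₂.h v' - T₂.h u') * T₁.weight v = (T₁.h v - T₁.h u) * T₂.weight v' := by
  have hadj : T₁.G.Adj v u := T₁.adj_iff.2 (Or.inr hu)
  have hadj' : T₂.G.Adj v' u' := T₂.adj_iff.2 (Or.inr hu')
  have hw₁ := T₁.weight_pos v
  have hw₂ := T₂.weight_pos v'
  have hΔ₁ : 0 < T₁.h v - T₁.h u := by rw [← hu]; linarith [T₁.h_lt_parent u]
  have hΔ₂ : 0 < T₂.h v' - T₂.h u' := by rw [← hu']; linarith [T₂.h_lt_parent u']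
  set b := (T₂.h v' - T₂.h u') * T₁.weight v / ((T₁.h v - T₁.h u) * T₂.weight v') with hb
  have hb1 : b = 1 := by
    refine hj.isHolomorphicIsometry.slope_eq_one (M₁.isOpen_annulus v u)
      (M₁.nonempty_annulus hadj) (a := (M₂.surf v').c0 - b * (M₁.surf v).c0)
      (by positivity) fun x hx => ?_
    have h1 := M₁.height_annulus hadj.ne' hx
    have h2 := M₂.height_annulus hadj'.ne' (hmap hx)
    rw [hj.mark_self] at h2
    have h3 : b * ((M₁.surf v).c0 - (M₁.surf v).height x) =
        (M₂.surf v').c0 - (M₂.surf v').height (j x) := by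
      rw [hb, div_mul_eq_mul_div, div_eq_iff (by positivity)]
      linear_combination (T₂.h v' - T₂.h u') * h1 - (T₁.h v - T₁.h u) * h2
    linarith
  rw [hb, div_eq_one_iff_eq (by positivity)] at hb1
  exact hb1

end IsMarkedIsometry

end Pair

namespace TreeOfLocalModels

/-! ### The first-return map -/

variable {V : Type*} {T : MetrizedPolynomialTree V} (M : TreeOfLocalModels.{u} T)

lemma totalMap_iterate_fst (n : ℕ) (z : M.Total) : (M.totalMap^[n] z).1 = T.F^[n] z.1 := by
  induction n with
  | zero => rfl
  | succ n ih => rw [Function.iterate_succ_apply', Function.iterate_succ_apply', ← ih]; rfl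

lemma returnTime_spec (v : V) : 0 < M.returnTime v ∧ T.F^[M.returnTime v] v ∈ T.spine :=
  Nat.sInf_mem (s := {i | 0 < i ∧ T.F^[i] v ∈ T.spine}) (T.exists_iterate_mem_spine v)

lemma iterate_notMem_spine {v : V} {i : ℕ} (hi : 0 < i) (hlt : i < M.returnTime v) :
    T.F^[i] v ∉ T.spine := fun h =>
  Nat.notMem_of_lt_sInf (s := {i | 0 < i ∧ T.F^[i] v ∈ T.spine}) hlt ⟨hi, h⟩

lemma returnTime_eq {v : V} {s : ℕ} (hs : 0 < s) (hmem : T.F^[s] v ∈ T.spine)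
    (hlt : ∀ i, 0 < i → i < s → T.F^[i] v ∉ T.spine) : M.returnTime v = s := by
  apply le_antisymm (Nat.sInf_le (s := {i | 0 < i ∧ T.F^[i] v ∈ T.spine}) ⟨hs, hmem⟩)
  by_contra! h
  exact hlt _ (M.returnTime_spec v).1 h (M.returnTime_spec v).2

/-- The first-return map on the vertices of the spine. -/
noncomputable def returnVertex (v : T.spine) : T.spine :=
  ⟨T.F^[M.returnTime v] v, (M.returnTime_spec v).2⟩

lemma exists_firstReturn_eq (x : M.Spine) :
    ∃ y : M.Spine, M.firstReturn x = M.incl y ∧ y.1 = M.returnVertex x.1 := by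
  have h : (M.firstReturn x).1 = M.returnVertex x.1 := M.totalMap_iterate_fst _ _
  refine ⟨⟨⟨(M.firstReturn x).1, h ▸ (M.returnVertex x.1).2⟩, (M.firstReturn x).2⟩, rfl, ?_⟩
  exact Subtype.ext h

lemma h_returnVertex (v : T.spine) : T.d * T.h v ≤ T.h (M.returnVertex v) := by
  change T.d * T.h v ≤ T.h (T.F^[M.returnTime v] v)
  rw [T.h_iterate_map]
  have h1 : (T.d : ℝ) ^ 1 ≤ (T.d : ℝ) ^ M.returnTime v :=
    pow_le_pow_right₀ T.one_lt_d.le (M.returnTime_spec v).1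
  rw [pow_one] at h1
  exact mul_le_mul_of_nonneg_right h1 (T.h_pos v).le

lemma h_returnVertex_iterate (n : ℕ) (v : T.spine) :
    (T.d : ℝ) ^ n * T.h v ≤ T.h (M.returnVertex^[n] v) := by
  induction n with
  | zero => simp
  | succ n ih =>
    rw [Function.iterate_succ_apply']
    refine le_trans ?_ (M.h_returnVertex _)
    rw [pow_succ', mul_assoc]
    exact mul_le_mul_of_nonneg_left ih T.d_pos.le

/-- On fibres over vertices of local degree one the dynamics is injective. -/
lemma totalMap_inj {a b : M.Total} (hab : a.1 = b.1) (hd : T.degV a.1 = 1)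
    (h : M.totalMap a = M.totalMap b) : a = b := by
  obtain ⟨v, x⟩ := a
  obtain ⟨w, y⟩ := b
  obtain rfl : v = w := hab
  have h1 : M.map v x = M.map v y := eq_of_heq (Sigma.mk.inj h).2
  rw [(M.isHolomorphicIsometry_map hd).bijective.1 h1]

lemma totalMap_iterate_inj {n : ℕ} {a b : M.Total} (hab : a.1 = b.1)
    (hd : ∀ i < n, T.degV (T.F^[i] a.1) = 1) (h : M.totalMap^[n] a = M.totalMap^[n] b) : a = b := by
  induction n with
  | zero => exact h
  | succ n ih =>
    refine ih (fun i hi => hd i (by omega)) ?_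
    rw [Function.iterate_succ_apply', Function.iterate_succ_apply'] at h
    refine M.totalMap_inj ?_ ?_ h
    · rw [totalMap_iterate_fst, totalMap_iterate_fst, hab]
    · rw [totalMap_iterate_fst]; exact hd n (by omega)

/-- The parent of a vertex of the spine, as a vertex of the spine. -/
noncomputable def _root_.MetrizedPolynomialTree.spineParent (T : MetrizedPolynomialTree V)
    (v : T.spine) : T.spine := ⟨T.parent v, T.parent_mem_spine v.2⟩

lemma spineParent_iterate (n : ℕ) (v : T.spine) :
    ((T.spineParent^[n] v : T.spine) : V) = T.parent^[n] v := by
  induction n with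
  | zero => rfl
  | succ n ih => rw [Function.iterate_succ_apply', Function.iterate_succ_apply', ← ih]; rfl

end TreeOfLocalModels

namespace SpineEquiv

open TreeOfLocalModels

/-! ### The isomorphism of the spines of the trees -/

variable {V₁ V₂ : Type*} {T₁ : MetrizedPolynomialTree V₁} {T₂ : MetrizedPolynomialTree V₂}
  {M₁ : TreeOfLocalModels.{u} T₁} {M₂ : TreeOfLocalModels.{u} T₂} (e : SpineEquiv M₁ M₂)

lemma isMarkedIsometry (v : T₁.spine) : IsMarkedIsometry M₁ M₂ (e.iso v) :=
  ⟨e.isHolomorphicIsometry v, e.mark_iso v v⟩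

lemma tree_returnVertex (v : T₁.spine) :
    e.tree (M₁.returnVertex v) = M₂.returnVertex (e.tree v) := by
  obtain ⟨x⟩ := (M₁.surf v).nonempty_of_surface
  obtain ⟨y, hy, hyv⟩ := M₁.exists_firstReturn_eq ⟨v, x⟩
  have h := congrArg Sigma.fst (e.conj ⟨v, x⟩ y hy)
  rw [← hyv]
  apply Subtype.ext
  refine Eq.trans h.symm ?_
  exact M₂.totalMap_iterate_fst _ _

lemma adj_tree_spineParent (v : T₁.spine) :
    T₂.G.Adj (e.tree v) (e.tree (T₁.spineParent v)) := by
  have h : (T₁.G.induce T₁.spine).Adj v (T₁.spineParent v) := T₁.adj_parent v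
  exact e.tree.map_rel_iff.2 h

/-- The isomorphism of spines respects the direction towards the isolated end: otherwise it would
send all ancestors of some vertex `v` to descendants of the image of `v`, but the first-return map
sends `v` to ancestors and raises heights on both sides. -/
lemma tree_spineParent (v : T₁.spine) : e.tree (T₁.spineParent v) = T₂.spineParent (e.tree v) := by
  by_contra hne
  have hdown : ∀ k, T₂.parent (e.tree (T₁.spineParent^[k + 1] v)) =
      e.tree (T₁.spineParent^[k] v) := by
    intro k
    induction k with
    | zero =>
      rcases T₂.adj_iff.1 (e.adj_tree_spineParent v) with h | h
      · exact absurd (Subtype.ext h) hne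
      · exact h
    | succ k ih =>
      have hadj := e.adj_tree_spineParent (T₁.spineParent^[k + 1] v)
      rw [← Function.iterate_succ_apply' T₁.spineParent] at hadj
      rcases T₂.adj_iff.1 hadj with h | h
      · rw [ih] at h
        have h1 := congrArg (fun w : T₁.spine => T₁.h w) (e.tree.injective (Subtype.ext h))
        simp only [spineParent_iterate] at h1
        have := (T₁.h_strictMono_parent v).injective h1
        omega
      · exact h
  have hle : ∀ k, T₂.h (e.tree (T₁.spineParent^[k] v)) ≤ T₂.h (e.tree v) := by
    intro k
    induction k with
    | zero => exact le_rfl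
    | succ k ih =>
      refine le_trans ?_ ih
      rw [← hdown k]
      exact (T₂.h_lt_parent _).le
  obtain ⟨C, hC⟩ := T₁.exists_eq_parent_iterate v
  obtain ⟨n, hn⟩ := pow_unbounded_of_one_lt (C / T₁.h v) T₁.one_lt_d
  have hn' : C ≤ T₁.h (M₁.returnVertex^[n + 1] v) := by
    refine le_trans ?_ (M₁.h_returnVertex_iterate (n + 1) v)
    have h1 : (T₁.d : ℝ) ^ n ≤ (T₁.d : ℝ) ^ (n + 1) :=
      pow_le_pow_right₀ T₁.one_lt_d.le (Nat.le_succ n)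
    exact ((div_lt_iff₀ (T₁.h_pos v)).1 (hn.trans_le h1)).le
  obtain ⟨i, hi⟩ := hC _ hn'
  have h1 : M₁.returnVertex^[n + 1] v = T₁.spineParent^[i] v :=
    Subtype.ext (hi.trans (spineParent_iterate i v).symm)
  have h2 : e.tree (M₁.returnVertex^[n + 1] v) = M₂.returnVertex^[n + 1] (e.tree v) :=
    (Function.Semiconj.iterate_right (f := e.tree) e.tree_returnVertex (n + 1)) v
  have h3 := hle i
  rw [← h1, h2] at h3
  have h4 := M₂.h_returnVertex_iterate (n + 1) (e.tree v)
  have h5 : 1 < (T₂.d : ℝ) ^ (n + 1) := one_lt_pow₀ T₂.one_lt_d (Nat.succ_ne_zero n)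
  have h6 := T₂.h_pos (e.tree v)
  nlinarith

lemma tree_spineParent_iterate (n : ℕ) (v : T₁.spine) :
    e.tree (T₁.spineParent^[n] v) = T₂.spineParent^[n] (e.tree v) :=
  (Function.Semiconj.iterate_right (f := e.tree) e.tree_spineParent n) v

lemma valence_tree (v : T₁.spine) : T₁.G.valence v = T₂.G.valence (e.tree v) :=
  (e.isMarkedIsometry v).valence_eq

lemma tree_top : (e.tree ⟨T₁.top, T₁.trunk_subset_spine T₁.top_mem_trunk⟩ : V₂) = T₂.top := by
  set t : T₁.spine := ⟨T₁.top, T₁.trunk_subset_spine T₁.top_mem_trunk⟩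
  have h3 : 3 ≤ T₂.G.valence (e.tree t) := by
    rw [← e.valence_tree]; exact T₁.three_le_valence_top
  have hlt : ∀ i, T₂.G.valence (T₂.parent^[i + 1] (e.tree t)) < 3 := fun i => by
    rw [← spineParent_iterate, ← e.tree_spineParent_iterate, ← e.valence_tree,
      spineParent_iterate]
    exact T₁.valence_parent_top_lt i
  rcases Nat.eq_zero_or_pos (T₂.depth (e.tree t)) with h | h
  · exact T₂.eq_top_of_mem_trunk (T₂.depth_eq_zero_iff.1 h) h3
  · obtain ⟨m, hm⟩ := Nat.exists_eq_succ_of_ne_zero h.ne'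
    have h1 := hlt m
    have h2 := T₂.parent_depth_eq_top h
    rw [hm] at h2
    rw [h2] at h1
    exact absurd T₂.three_le_valence_top (not_le.2 h1)

lemma tree_parent_iterate_top (i : ℕ) (h : T₁.parent^[i] T₁.top ∈ T₁.spine) :
    (e.tree ⟨T₁.parent^[i] T₁.top, h⟩ : V₂) = T₂.parent^[i] T₂.top := by
  have h1 : (⟨T₁.parent^[i] T₁.top, h⟩ : T₁.spine) =
      T₁.spineParent^[i] ⟨T₁.top, T₁.trunk_subset_spine T₁.top_mem_trunk⟩ :=
    Subtype.ext (spineParent_iterate (T := T₁) i ⟨T₁.top, _⟩).symm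
  rw [h1, e.tree_spineParent_iterate, spineParent_iterate, e.tree_top]

lemma tree_mem_trunk {v : T₁.spine} (hv : (v : V₁) ∈ T₁.trunk) : (e.tree v : V₂) ∈ T₂.trunk := by
  obtain ⟨v, hvs⟩ := v
  obtain ⟨i, rfl⟩ := hv
  exact ⟨i, (e.tree_parent_iterate_top i hvs).symm⟩

/-! ### Construction of the extension -/

open Classical in
/-- The recursion step of the construction. Over a vertex `v` of the spine, the isomorphism
is given. Otherwise, let `p` and `q` be the isometries constructed over the parent of `v` and over
`F v`: then `p` maps the annulus over the edge from the parent to `v` to the annulus of an edge,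
whose lower endpoint `v'` corresponds to `v`, and the isometry over `v` is the lift of `q` to the
local model maps at `v` and `v'`, which are of degree one. -/
noncomputable def extendStep (v : V₁)
    (ih : ∀ w, T₁.depth w < T₁.depth v → Σ w' : V₂, (M₁.surf w → M₂.surf w')) :
    Σ v' : V₂, (M₁.surf v → M₂.surf v') :=
  if hv : v ∈ T₁.spine then ⟨e.tree ⟨v, hv⟩, e.iso ⟨v, hv⟩⟩
  else
    let p := ih (T₁.parent v) (T₁.depth_parent_lt (T₁.depth_pos_of_notMem_spine hv))
    let q := ih (T₁.F v) (T₁.depth_map_lt (T₁.depth_pos_of_notMem_spine hv))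
    let v' := @Classical.epsilon V₂ ⟨p.1⟩ fun u' => T₂.G.Adj p.1 u' ∧
      Set.MapsTo p.2 (M₁.annulus (T₁.parent v) v) (M₂.annulus p.1 u')
    ⟨v', fun x => Classical.epsilon fun y => M₂.totalMap ⟨v', y⟩ = ⟨q.1, q.2 (M₁.map v x)⟩⟩

/-- The extension of an isomorphism of spines: for every vertex `v` of `T₁` the corresponding vertex
of `T₂` together with the isometry between the local model surfaces. -/
noncomputable def extend : ∀ v, Σ v' : V₂, (M₁.surf v → M₂.surf v') :=
  WellFounded.fix (measure T₁.depth).wf e.extendStep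

lemma extend_spine (v : T₁.spine) : e.extend v = ⟨e.tree v, e.iso v⟩ := by
  unfold extend
  rw [WellFounded.fix_eq, extendStep, dif_pos v.2]

/-- The recursion step off the spine does what it should, provided that the vertex and the points it
chooses exist. -/
lemma extend_of_notMem {v : V₁} (hv : v ∉ T₁.spine)
    (h : ∃ u', T₂.G.Adj (e.extend (T₁.parent v)).1 u' ∧
      Set.MapsTo (e.extend (T₁.parent v)).2 (M₁.annulus (T₁.parent v) v)
        (M₂.annulus (e.extend (T₁.parent v)).1 u')) :
    T₂.G.Adj (e.extend (T₁.parent v)).1 (e.extend v).1 ∧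
      Set.MapsTo (e.extend (T₁.parent v)).2 (M₁.annulus (T₁.parent v) v)
        (M₂.annulus (e.extend (T₁.parent v)).1 (e.extend v).1) ∧
      ∀ x, (∃ y, M₂.totalMap ⟨(e.extend v).1, y⟩ =
          ⟨(e.extend (T₁.F v)).1, (e.extend (T₁.F v)).2 (M₁.map v x)⟩) →
        M₂.totalMap ⟨(e.extend v).1, (e.extend v).2 x⟩ =
          ⟨(e.extend (T₁.F v)).1, (e.extend (T₁.F v)).2 (M₁.map v x)⟩ := by
  have heq : e.extend v = e.extendStep v fun w _ => e.extend w := by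
    conv_lhs => rw [extend, WellFounded.fix_eq]
    rfl
  rw [extendStep, dif_neg hv] at heq
  have h1 := @Classical.epsilon_spec_aux V₂ ⟨(e.extend (T₁.parent v)).1⟩ _ h
  rw [heq]
  exact ⟨h1.1, h1.2, fun x hx => Classical.epsilon_spec hx⟩

/-- The map of total spaces given by the extension. -/
noncomputable def extendTotal (z : M₁.Total) : M₂.Total :=
  ⟨(e.extend z.1).1, (e.extend z.1).2 z.2⟩

/-- The properties of the extension over a vertex `v` that are carried through the induction. -/
structure IsGood (v : V₁) : Prop where
  isMarked : IsMarkedIsometry M₁ M₂ (e.extend v).2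
  notMem_spine : v ∉ T₁.spine → (e.extend v).1 ∉ T₂.spine
  parent_eq : T₂.parent (e.extend v).1 = (e.extend (T₁.parent v)).1
  mapsTo_below : ∀ w, T₁.parent v = w →
    Set.MapsTo (e.extend w).2 (M₁.annulus w v) (M₂.annulus (e.extend w).1 (e.extend v).1)
  mapsTo_above : ∀ w, T₁.parent v = w →
    Set.MapsTo (e.extend v).2 (M₁.annulus v w) (M₂.annulus (e.extend v).1 (e.extend w).1)
  conj : ∀ x, M₂.totalMap (e.extendTotal ⟨v, x⟩) = e.extendTotal (M₁.totalMap ⟨v, x⟩)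

variable {e}

lemma IsGood.map_eq {v : V₁} (h : e.IsGood v) : T₂.F (e.extend v).1 = (e.extend (T₁.F v)).1 := by
  obtain ⟨x⟩ := (M₁.surf v).nonempty_of_surface
  exact congrArg Sigma.fst (h.conj x)

variable (e)

lemma parent_extend_spine (v : T₁.spine) :
    T₂.parent (e.extend v).1 = (e.extend (T₁.parent v)).1 := by
  have h : e.extend (T₁.parent v) = ⟨e.tree (T₁.spineParent v), e.iso (T₁.spineParent v)⟩ :=
    e.extend_spine (T₁.spineParent v)
  rw [e.extend_spine, h]
  exact (congrArg Subtype.val (e.tree_spineParent v)).symm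

lemma mapsTo_below_spine (v : T₁.spine) (w : V₁) (hw : T₁.parent v = w) :
    Set.MapsTo (e.extend w).2 (M₁.annulus w v) (M₂.annulus (e.extend w).1 (e.extend v).1) := by
  subst hw
  have h1 := e.extend_spine v
  have h2 := e.extend_spine (T₁.spineParent v)
  change e.extend (T₁.parent v) = _ at h2
  rw [h1, h2]
  intro x hx
  have := e.mark_iso (T₁.spineParent v) v x
  exact lt_of_lt_of_eq hx this.symm

lemma mapsTo_above_spine (v : T₁.spine) (w : V₁) (hw : T₁.parent v = w) :
    Set.MapsTo (e.extend v).2 (M₁.annulus v w) (M₂.annulus (e.extend v).1 (e.extend w).1) := by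
  subst hw
  have h1 := e.extend_spine v
  have h2 := e.extend_spine (T₁.spineParent v)
  change e.extend (T₁.parent v) = _ at h2
  rw [h1, h2]
  intro x hx
  have := e.mark_iso v (T₁.spineParent v) x
  exact lt_of_lt_of_eq hx this.symm

/-- The tree map conjugates the dynamics at `v` if this is known at the parent: the annulus
over the edge above `v` can be followed under the conjugacy over the parent. -/
lemma map_extend_eq {v : V₁} (hw : e.IsGood (T₁.parent v)) (hF : e.IsGood (T₁.F v))
    (hp : T₂.parent (e.extend v).1 = (e.extend (T₁.parent v)).1)
    (hm : Set.MapsTo (e.extend (T₁.parent v)).2 (M₁.annulus (T₁.parent v) v)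
      (M₂.annulus (e.extend (T₁.parent v)).1 (e.extend v).1)) :
    T₂.F (e.extend v).1 = (e.extend (T₁.F v)).1 := by
  set w := T₁.parent v with hwdef
  have hadj : T₁.G.Adj w v := (T₁.adj_parent v).symm
  have hadj' : T₂.G.Adj (e.extend w).1 (e.extend v).1 := T₂.adj_iff.2 (Or.inr hp)
  obtain ⟨x, hx⟩ := M₁.nonempty_annulus hadj
  have h1 := M₂.map_mem_annulus hadj' (hm hx)
  have h2 := hF.mapsTo_below (T₁.F w) (T₁.map_parent v).symm (M₁.map_mem_annulus hadj hx)
  have h3 : (M₂.totalMap (e.extendTotal ⟨w, x⟩)).2 ∈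
      M₂.annulus (M₂.totalMap (e.extendTotal ⟨w, x⟩)).1 (T₂.F (e.extend v).1) := h1
  rw [hw.conj x] at h3
  refine M₂.eq_of_mem_annulus (v := (e.extend (T₁.F w)).1) ?_ ?_ h3 h2
  · rw [← hw.map_eq]
    exact (T₂.map_adj hadj').ne'
  · have := hF.parent_eq
    rw [← T₁.map_parent v, ← hwdef] at this
    rw [← this]
    exact (T₂.parent_ne _).symm

/-- Over the spine, the extension conjugates not only the first-return maps but the maps themselves:
between two visits to the spine the dynamics is injective. -/
lemma conj_spine (v : T₁.spine) (ih : ∀ w, T₁.depth w < T₁.depth v → e.IsGood w)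
    (hF : T₂.F (e.extend v).1 = (e.extend (T₁.F v)).1) (x : M₁.surf v) :
    M₂.totalMap (e.extendTotal ⟨v, x⟩) = e.extendTotal (M₁.totalMap ⟨v, x⟩) := by
  set z : M₁.Total := ⟨v, x⟩ with hz
  set s := M₁.returnTime v with hs
  obtain ⟨hs0, hsmem⟩ := M₁.returnTime_spec (v : V₁)
  have hdepth : ∀ i, 0 < i → i < s → T₁.depth (T₁.F^[i] v) < T₁.depth v := by
    intro i hi his
    induction i with
    | zero => exact absurd hi (lt_irrefl 0)
    | succ i ihi =>
      have hpos : 0 < T₁.depth (T₁.F^[i] v) := by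
        rw [Nat.pos_iff_ne_zero]
        intro h0
        have h1 := T₁.map_mem_trunk (T₁.depth_eq_zero_iff.1 h0)
        rw [← Function.iterate_succ_apply' T₁.F] at h1
        exact M₁.iterate_notMem_spine (Nat.succ_pos i) his (T₁.trunk_subset_spine h1)
      have h2 := T₁.depth_map_lt hpos
      rw [Function.iterate_succ_apply']
      rcases Nat.eq_zero_or_pos i with rfl | hi0
      · exact h2
      · exact h2.trans (ihi hi0 (by omega))
  have hiter : ∀ i, i < s → e.extendTotal (M₁.totalMap^[i + 1] z) =
      M₂.totalMap^[i] (e.extendTotal (M₁.totalMap z)) := by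
    intro i his
    induction i with
    | zero => rfl
    | succ i ihi =>
      rw [Function.iterate_succ_apply' M₂.totalMap, ← ihi (by omega),
        Function.iterate_succ_apply' M₁.totalMap]
      have hg := ih _ (hdepth (i + 1) (Nat.succ_pos i) his)
      rw [← M₁.totalMap_iterate_fst (i + 1) z] at hg
      exact (hg.conj _).symm
  have hfst : ∀ i, 0 < i → i ≤ s → (e.extend (T₁.F^[i] v)).1 = T₂.F^[i] (e.extend v).1 := by
    intro i hi his
    obtain ⟨k, rfl⟩ := Nat.exists_eq_succ_of_ne_zero hi.ne'
    have h1 := congrArg Sigma.fst (hiter k (by omega))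
    rw [M₂.totalMap_iterate_fst] at h1
    change (e.extend (M₁.totalMap^[k + 1] z).1).1 = _ at h1
    rw [M₁.totalMap_iterate_fst] at h1
    rw [Function.iterate_succ_apply T₂.F, hF]
    exact h1
  have hret : M₂.returnTime (e.extend v).1 = s := by
    refine M₂.returnTime_eq hs0 ?_ fun i hi his => ?_
    · rw [← hfst s hs0 le_rfl, e.extend_spine ⟨_, hsmem⟩]
      exact (e.tree _).2
    · rw [← hfst i hi his.le]
      exact (ih _ (hdepth i hi his)).notMem_spine (M₁.iterate_notMem_spine hi his)
  obtain ⟨k, hk⟩ := Nat.exists_eq_succ_of_ne_zero hs0.ne'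
  have hks : s = k + 1 := hk
  -- The conjugacy of the first-return maps.
  have hcr : M₂.totalMap^[s] (e.extendTotal z) = e.extendTotal (M₁.totalMap^[s] z) := by
    obtain ⟨y, hy, -⟩ := M₁.exists_firstReturn_eq ⟨v, x⟩
    have h1 := e.conj ⟨v, x⟩ y hy
    have h2 : ∀ y : M₁.Spine, e.extendTotal (M₁.incl y) = M₂.incl (Sigma.map e.tree e.iso y) := by
      rintro ⟨y, t⟩
      change (⟨(e.extend y).1, (e.extend y).2 t⟩ : M₂.Total) = ⟨e.tree y, e.iso y t⟩
      rw [e.extend_spine y]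
    have h3 : M₁.firstReturn ⟨v, x⟩ = M₁.totalMap^[s] z := rfl
    rw [← h3, hy, h2, ← h1]
    change _ = M₂.totalMap^[M₂.returnTime (e.tree v)] (M₂.incl (Sigma.map e.tree e.iso ⟨v, x⟩))
    rw [← h2]
    rw [e.extend_spine v] at hret
    rw [hret]
    rfl
  rw [hks, Function.iterate_succ_apply, hiter k (by omega)] at hcr
  refine M₂.totalMap_iterate_inj (n := k) hF (fun i hi => ?_) hcr
  change T₂.degV (T₂.F^[i] (T₂.F (e.extend v).1)) = 1
  rw [← Function.iterate_succ_apply T₂.F, ← hfst (i + 1) (Nat.succ_pos i) (by omega)]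
  exact T₂.degV_eq_one ((ih _ (hdepth (i + 1) (Nat.succ_pos i) (by omega))).notMem_spine
    (M₁.iterate_notMem_spine (Nat.succ_pos i) (by omega)))

lemma isGood_spine (v : T₁.spine) (ih : ∀ w, T₁.depth w < T₁.depth v → e.IsGood w) :
    e.IsGood v := by
  have hF : T₂.F (e.extend v).1 = (e.extend (T₁.F v)).1 := by
    rcases Nat.eq_zero_or_pos (T₁.depth v) with h0 | hpos
    · have hv := T₁.depth_eq_zero_iff.1 h0
      have hFv := T₁.trunk_subset_spine (T₁.map_mem_trunk hv)
      have hFv' := T₂.trunk_subset_spine (T₂.map_mem_trunk (e.tree_mem_trunk hv))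
      have h1 : M₁.returnTime v = 1 :=
        M₁.returnTime_eq one_pos hFv fun i h1 h2 => by omega
      have h2 : M₂.returnTime (e.tree v) = 1 :=
        M₂.returnTime_eq one_pos hFv' fun i h1 h2 => by omega
      have h3 := congrArg Subtype.val (e.tree_returnVertex v)
      have h4 : M₁.returnVertex v = ⟨T₁.F v, hFv⟩ := by
        apply Subtype.ext
        change T₁.F^[M₁.returnTime v] v = _
        rw [h1]; rfl
      rw [e.extend_spine v, e.extend_spine ⟨T₁.F v, hFv⟩]
      rw [h4] at h3
      refine Eq.trans ?_ h3.symm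
      change _ = T₂.F^[M₂.returnTime (e.tree v)] (e.tree v)
      rw [h2]; rfl
    · exact e.map_extend_eq (ih _ (T₁.depth_parent_lt hpos)) (ih _ (T₁.depth_map_lt hpos))
        (e.parent_extend_spine v) (e.mapsTo_below_spine v _ rfl)
  refine ⟨?_, fun h => absurd v.2 h, e.parent_extend_spine v, e.mapsTo_below_spine v,
    e.mapsTo_above_spine v, e.conj_spine v ih hF⟩
  rw [e.extend_spine v]
  exact e.isMarkedIsometry v

/-- Lifts of holomorphic isometries to local model maps of degree one. -/
lemma isMarkedIsometry_of_lift {v : V₁} {v' : V₂} {j : M₁.surf v → M₂.surf v'}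
    {q : Σ w' : V₂, (M₁.surf (T₁.F v) → M₂.surf w')} (hv : T₁.degV v = 1) (hv' : T₂.degV v' = 1)
    (hq : IsMarkedIsometry M₁ M₂ q.2) (hFv : T₂.F v' = q.1)
    (hj : ∀ x, M₂.totalMap ⟨v', j x⟩ = ⟨q.1, q.2 (M₁.map v x)⟩) : IsMarkedIsometry M₁ M₂ j := by
  obtain ⟨w', k⟩ := q
  obtain rfl : T₂.F v' = w' := hFv
  have hj' : ∀ x, M₂.map v' (j x) = k (M₁.map v x) := fun x => eq_of_heq (Sigma.mk.inj (hj x)).2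
  refine ⟨?_, fun x => ?_⟩
  · refine (M₂.isHolomorphicIsometry_map hv').of_comp ?_
    have : M₂.map v' ∘ j = k ∘ M₁.map v := funext hj'
    rw [this]
    exact hq.isHolomorphicIsometry.comp (M₁.isHolomorphicIsometry_map hv)
  · rw [← M₂.mark_map_self, hj', hq.mark_self, M₁.mark_map_self]

lemma isGood_of_notMem {v : V₁} (hv : v ∉ T₁.spine) (hw : e.IsGood (T₁.parent v))
    (hF : e.IsGood (T₁.F v)) : e.IsGood v := by
  have hadj : T₁.G.Adj (T₁.parent v) v := (T₁.adj_parent v).symm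
  obtain ⟨hadj', hmaps, hlift⟩ := e.extend_of_notMem hv (hw.isMarked.exists_mapsTo hadj)
  have hparent : T₂.parent (e.extend v).1 = (e.extend (T₁.parent v)).1 := by
    refine (T₂.adj_iff.1 hadj').resolve_left fun h => ?_
    rw [hw.parent_eq] at h
    have h1 := hw.mapsTo_above _ rfl
    rw [← h] at h1
    have h2 := hw.isMarked.eq_of_mapsTo hadj (T₁.adj_parent _) hadj' hmaps h1
    have h3 := T₁.h_lt_parent v
    have h4 := T₁.h_lt_parent (T₁.parent v)
    rw [← h2] at h4
    exact lt_asymm h3 h4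
  have hnot : (e.extend v).1 ∉ T₂.spine := by
    intro hmem
    have hws : T₁.parent v ∈ T₁.spine := by
      by_contra h
      apply hw.notMem_spine h
      rw [← hparent]
      exact T₂.parent_mem_spine hmem
    set u : T₁.spine := e.tree.symm ⟨_, hmem⟩ with hu
    have htu : e.tree u = ⟨_, hmem⟩ := e.tree.apply_symm_apply _
    have hpu : T₁.spineParent u = ⟨T₁.parent v, hws⟩ := by
      apply e.tree.injective
      rw [e.tree_spineParent, htu]
      apply Subtype.ext
      have h1 := hparent
      rw [e.extend_spine ⟨_, hws⟩] at h1
      exact h1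
    have hpu' : T₁.parent u = T₁.parent v := congrArg Subtype.val hpu
    have hm := e.mapsTo_below_spine u _ hpu'
    have hext : (e.extend u).1 = (e.extend v).1 := by
      rw [e.extend_spine u]
      exact congrArg Subtype.val htu
    rw [hext] at hm
    have huv := hw.isMarked.eq_of_mapsTo (T₁.adj_iff.2 (Or.inr hpu')) hadj hadj' hm hmaps
    exact hv (huv ▸ u.2)
  have hmap := e.map_extend_eq hw hF hparent hmaps
  have hd := T₁.degV_eq_one hv
  have hd' := T₂.degV_eq_one hnot
  have hconj : ∀ x, M₂.totalMap ⟨(e.extend v).1, (e.extend v).2 x⟩ =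
      ⟨(e.extend (T₁.F v)).1, (e.extend (T₁.F v)).2 (M₁.map v x)⟩ := by
    intro x
    apply hlift x
    have hsurj := (M₂.isHolomorphicIsometry_map hd').bijective.2
    generalize e.extend (T₁.F v) = q at hmap
    obtain ⟨w', k⟩ := q
    obtain rfl : T₂.F (e.extend v).1 = w' := hmap
    obtain ⟨y, hy⟩ := hsurj (k (M₁.map v x))
    exact ⟨y, congrArg (Sigma.mk (T₂.F (e.extend v).1)) hy⟩
  have hmarked := isMarkedIsometry_of_lift hd hd' hF.isMarked hmap hconj
  refine ⟨hmarked, fun _ => hnot, hparent, ?_, ?_, hconj⟩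
  · rintro w rfl
    exact hmaps
  · rintro w rfl x hx
    have hadjv := T₁.adj_parent v
    obtain ⟨u, hu, hxu⟩ := M₂.exists_mem_annulus (x := (e.extend v).2 x) (v := (e.extend v).1)
      (by rw [hmarked.mark_self]; exact M₁.mark_self_lt_one hadjv.ne' hx)
    have h1 := M₂.map_mem_annulus hu hxu
    have h2 := hF.mapsTo_above _ (T₁.map_parent v).symm (M₁.map_mem_annulus hadjv hx)
    have h3 : (M₂.totalMap ⟨(e.extend v).1, (e.extend v).2 x⟩).2 ∈
      M₂.annulus (M₂.totalMap ⟨(e.extend v).1, (e.extend v).2 x⟩).1 (T₂.F u) := h1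
    rw [hconj x] at h3
    have h4 : (e.extend (T₁.F (T₁.parent v))).1 = T₂.F (T₂.parent (e.extend v).1) := by
      rw [hparent, hw.map_eq]
    rw [h4] at h2
    have h5 : T₂.F u = T₂.F (T₂.parent (e.extend v).1) := by
      refine M₂.eq_of_mem_annulus (v := (e.extend (T₁.F v)).1) ?_ ?_ h3 h2
      · rw [← hmap]; exact (T₂.map_adj hu).ne'
      · rw [← hmap]; exact (T₂.map_adj (T₂.adj_parent _)).ne'
    rw [T₂.eq_parent_of_map_eq hu h5, hparent] at hxu
    exact hxu

theorem isGood (v : V₁) : e.IsGood v := by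
  induction hn : T₁.depth v using Nat.strong_induction_on generalizing v with
  | _ n ih =>
    subst hn
    have ih' : ∀ w, T₁.depth w < T₁.depth v → e.IsGood w := fun w hw => ih _ hw w rfl
    by_cases hv : v ∈ T₁.spine
    · exact e.isGood_spine ⟨v, hv⟩ ih'
    · have hpos := T₁.depth_pos_of_notMem_spine hv
      exact e.isGood_of_notMem hv (ih' _ (T₁.depth_parent_lt hpos))
        (ih' _ (T₁.depth_map_lt hpos))

end SpineEquiv

section Degree

open TreeOfLocalModels

variable {V₁ V₂ : Type*} {T₁ : MetrizedPolynomialTree V₁} {T₂ : MetrizedPolynomialTree V₂}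
  {M₁ : TreeOfLocalModels.{u} T₁} {M₂ : TreeOfLocalModels.{u} T₂}

/-! ### Degrees and heights under the extension -/

/-- Conjugate local model maps have the same degree. -/
lemma degV_eq_of_conj {v : V₁} {v' : V₂} {i : M₁.surf v → M₂.surf v'}
    {q : Σ w' : V₂, (M₁.surf (T₁.F v) → M₂.surf w')} (hi : Function.Bijective i)
    (hq : Function.Bijective q.2)
    (h : ∀ x, M₂.totalMap ⟨v', i x⟩ = ⟨q.1, q.2 (M₁.map v x)⟩) : T₁.degV v = T₂.degV v' := by
  obtain ⟨w', k⟩ := q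
  obtain ⟨x₀⟩ := (M₁.surf v).nonempty_of_surface
  obtain rfl : T₂.F v' = w' := congrArg Sigma.fst (h x₀)
  exact (M₁.isLocalModelMap v).isBranchedCover.degree_eq (M₂.isLocalModelMap v').isBranchedCover
    hi hq fun x => (eq_of_heq (Sigma.mk.inj (h x)).2).symm

end Degree

namespace SpineEquiv

open TreeOfLocalModels

variable {V₁ V₂ : Type*} {T₁ : MetrizedPolynomialTree V₁} {T₂ : MetrizedPolynomialTree V₂}
  {M₁ : TreeOfLocalModels.{u} T₁} {M₂ : TreeOfLocalModels.{u} T₂} (e : SpineEquiv M₁ M₂)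

lemma extend_mem_spine_iff (v : V₁) : (e.extend v).1 ∈ T₂.spine ↔ v ∈ T₁.spine := by
  refine ⟨fun h => by_contra fun hv => (e.isGood v).notMem_spine hv h, fun h => ?_⟩
  rw [e.extend_spine ⟨v, h⟩]
  exact (e.tree _).2

lemma mapsTo_annulus {v u : V₁} (hu : T₁.G.Adj v u) :
    Set.MapsTo (e.extend v).2 (M₁.annulus v u) (M₂.annulus (e.extend v).1 (e.extend u).1) := by
  rcases T₁.adj_iff.1 hu with h | h
  · exact (e.isGood v).mapsTo_above u h.symm
  · exact (e.isGood u).mapsTo_below v h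

lemma extend_injective : Function.Injective fun v => (e.extend v).1 := by
  intro v w h
  change (e.extend v).1 = (e.extend w).1 at h
  induction hn : T₁.depth v using Nat.strong_induction_on generalizing v w with
  | _ n ih =>
    subst hn
    by_cases hv : v ∈ T₁.spine
    · have hw : w ∈ T₁.spine := by
        rw [← e.extend_mem_spine_iff, ← h, e.extend_mem_spine_iff]; exact hv
      rw [e.extend_spine ⟨v, hv⟩, e.extend_spine ⟨w, hw⟩] at h
      exact congrArg Subtype.val (e.tree.injective (Subtype.ext h))
    · have hp : T₁.parent v = T₁.parent w := by
        refine ih _ (T₁.depth_parent_lt (T₁.depth_pos_of_notMem_spine hv)) ?_ rfl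
        rw [← (e.isGood v).parent_eq, ← (e.isGood w).parent_eq, h]
      have hv' := (e.isGood v).mapsTo_below _ rfl
      have hw' := (e.isGood w).mapsTo_below _ hp.symm
      rw [← h] at hw'
      exact (e.isGood (T₁.parent v)).isMarked.eq_of_mapsTo (T₁.adj_parent v).symm
        (T₁.adj_iff.2 (Or.inr hp.symm)) (T₂.adj_iff.2 (Or.inr (e.isGood v).parent_eq)) hv' hw'

lemma extend_parent_iterate_top (i : ℕ) :
    (e.extend (T₁.parent^[i] T₁.top)).1 = T₂.parent^[i] T₂.top := by
  rw [e.extend_spine ⟨_, T₁.trunk_subset_spine ⟨i, rfl⟩⟩]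
  exact e.tree_parent_iterate_top i _

lemma extend_surjective : Function.Surjective fun v => (e.extend v).1 := by
  intro v'
  change ∃ v, (e.extend v).1 = v'
  induction hn : T₂.depth v' using Nat.strong_induction_on generalizing v' with
  | _ n ih =>
    subst hn
    rcases Nat.eq_zero_or_pos (T₂.depth v') with h0 | hpos
    · obtain ⟨i, rfl⟩ := T₂.depth_eq_zero_iff.1 h0
      exact ⟨_, e.extend_parent_iterate_top i⟩
    · obtain ⟨w, hw⟩ := ih _ (T₂.depth_parent_lt hpos) (T₂.parent v') rfl
      have hadj : T₂.G.Adj (e.extend w).1 v' := T₂.adj_iff.2 (Or.inr hw.symm)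
      obtain ⟨u, hu, hm⟩ := (e.isGood w).isMarked.exists_mapsTo_of_adj hadj
      obtain ⟨x, hx⟩ := M₁.nonempty_annulus hu
      have hne : (e.extend u).1 ≠ (e.extend w).1 := fun h => hu.ne' (e.extend_injective h)
      exact ⟨u, M₂.eq_of_mem_annulus hne hadj.ne' (e.mapsTo_annulus hu hx) (hm hx)⟩

/-- The isomorphism of trees extending the isomorphism of spines. -/
noncomputable def treeIso : T₁.G ≃g T₂.G where
  toEquiv := Equiv.ofBijective (fun v => (e.extend v).1) ⟨e.extend_injective, e.extend_surjective⟩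
  map_rel_iff' := by
    intro v w
    change T₂.G.Adj (e.extend v).1 (e.extend w).1 ↔ _
    rw [T₂.adj_iff, T₁.adj_iff, (e.isGood v).parent_eq, (e.isGood w).parent_eq]
    exact or_congr e.extend_injective.eq_iff e.extend_injective.eq_iff

lemma degV_extend (v : V₁) : T₂.degV (e.extend v).1 = T₁.degV v :=
  (degV_eq_of_conj (q := e.extend (T₁.F v)) (e.isGood v).isMarked.isHolomorphicIsometry.bijective
    (e.isGood (T₁.F v)).isMarked.isHolomorphicIsometry.bijective (e.isGood v).conj).symm

lemma extend_map_iterate (n : ℕ) (v : V₁) :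
    (e.extend (T₁.F^[n] v)).1 = T₂.F^[n] (e.extend v).1 := by
  induction n with
  | zero => rfl
  | succ n ih =>
    rw [Function.iterate_succ_apply', Function.iterate_succ_apply', ← ih, (e.isGood _).map_eq]

lemma extend_top : (e.extend T₁.top).1 = T₂.top := e.extend_parent_iterate_top 0

lemma d_eq (e : SpineEquiv M₁ M₂) : T₂.d = T₁.d := by
  rw [← T₂.degV_top, ← T₁.degV_top, ← e.extend_top, e.degV_extend]

lemma h_sub_extend {v w : V₁} (hw : T₁.parent v = w)
    (hweight : T₂.weight (e.extend w).1 = T₁.weight w) :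
    T₂.h (e.extend w).1 - T₂.h (e.extend v).1 = T₁.h w - T₁.h v := by
  have hp : T₂.parent (e.extend v).1 = (e.extend w).1 := by rw [(e.isGood v).parent_eq, hw]
  have h := (e.isGood w).isMarked.edge_length hw hp ((e.isGood v).mapsTo_below w hw)
  rw [hweight] at h
  exact mul_right_cancel₀ (T₁.weight_pos w).ne' h

lemma h_trunk_sub (e : SpineEquiv M₁ M₂) (i : ℕ) :
    T₂.h (T₂.parent^[i] T₂.top) - T₂.h T₂.top = T₁.h (T₁.parent^[i] T₁.top) - T₁.h T₁.top := by
  induction i with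
  | zero => simp
  | succ i ih =>
    have h := e.h_sub_extend (v := T₁.parent^[i] T₁.top) (w := T₁.parent^[i + 1] T₁.top)
      (Function.iterate_succ_apply' _ _ _).symm (by
        rw [e.extend_parent_iterate_top, T₁.weight_trunk ⟨i + 1, rfl⟩,
          T₂.weight_trunk ⟨i + 1, rfl⟩])
    rw [e.extend_parent_iterate_top, e.extend_parent_iterate_top] at h
    linarith

/-- The height of the highest branching vertex is determined by the lengths of edges of the trunk,
since the difference of the heights of this vertex and its image is `d - 1` times its height. -/
lemma h_top_eq (e : SpineEquiv M₁ M₂) : T₂.h T₂.top = T₁.h T₁.top := by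
  obtain ⟨N, hN⟩ := T₁.exists_map_top
  have hN' : T₂.F T₂.top = T₂.parent^[N + 1] T₂.top := by
    rw [← e.extend_top, (e.isGood _).map_eq, hN, e.extend_parent_iterate_top, e.extend_top]
  have h := e.h_trunk_sub (N + 1)
  rw [← hN, ← hN', T₁.h_map, T₂.h_map, e.d_eq] at h
  have hd := T₁.one_lt_d
  have h2 : ((T₁.d : ℝ) - 1) * T₂.h T₂.top = (T₁.d - 1) * T₁.h T₁.top := by linarith
  exact mul_left_cancel₀ (by linarith : (T₁.d : ℝ) - 1 ≠ 0) h2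

lemma weight_extend {v : V₁} (h : T₂.h (e.extend v).1 = T₁.h v) :
    T₂.weight (e.extend v).1 = T₁.weight v := by
  have hl : T₂.level (e.extend v).1 = T₁.level v := by
    rw [T₁.level_eq, T₂.level_eq, e.h_top_eq, e.d_eq, h]
  unfold MetrizedPolynomialTree.weight
  rw [hl, e.d_eq]
  congr 1
  refine Finset.prod_congr rfl fun i _ => ?_
  rw [← e.extend_map_iterate, e.degV_extend]

lemma h_extend (v : V₁) : T₂.h (e.extend v).1 = T₁.h v := by
  induction hn : T₁.depth v using Nat.strong_induction_on generalizing v with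
  | _ n ih =>
    subst hn
    rcases Nat.eq_zero_or_pos (T₁.depth v) with h0 | hpos
    · obtain ⟨i, rfl⟩ := T₁.depth_eq_zero_iff.1 h0
      have h1 := e.h_trunk_sub i
      rw [e.h_top_eq] at h1
      change T₂.h (e.extend (T₁.parent^[i] T₁.top)).1 = T₁.h (T₁.parent^[i] T₁.top)
      rw [e.extend_parent_iterate_top]
      linarith
    · have hw := ih _ (T₁.depth_parent_lt hpos) (T₁.parent v) rfl
      have h1 := e.h_sub_extend rfl (e.weight_extend hw)
      linarith

lemma mark_extend (v : V₁) (x : M₁.surf v) :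
    (M₂.mark (e.extend v).1 ((e.extend v).2 x) : V₂ → ℝ) =
      pushPoint (fun v => (e.extend v).1) (M₁.mark v x) := by
  have hself := (e.isGood v).isMarked.mark_self x
  funext w'
  obtain ⟨w, rfl⟩ := e.extend_surjective w'
  rw [pushPoint_apply_of_injective e.extend_injective]
  change (M₂.mark (e.extend v).1 ((e.extend v).2 x) : V₂ → ℝ) (e.extend w).1 = _
  by_cases hwv : w = v
  · subst hwv
    exact hself
  have hne : (e.extend w).1 ≠ (e.extend v).1 := fun h => hwv (e.extend_injective h)
  by_cases hx : x ∈ M₁.annulus v w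
  · have hadj := (T₁.of_mem_star_of_pos (M₁.mark v x).2 hwv hx).1
    have h1 := M₁.mark_add_mark hwv hx
    have h2 := M₂.mark_add_mark hne (e.mapsTo_annulus hadj hx)
    linarith
  · have h0 : (M₁.mark v x : V₁ → ℝ) w = 0 :=
      le_antisymm (not_lt.1 hx) ((M₁.mark v x).2.1.1 w)
    rw [h0]
    by_contra hcon
    have hpos : (e.extend v).2 x ∈ M₂.annulus (e.extend v).1 (e.extend w).1 :=
      lt_of_le_of_ne ((M₂.mark (e.extend v).1 ((e.extend v).2 x)).2.1.1 _) (Ne.symm hcon)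
    obtain ⟨u, hu, hxu⟩ := M₁.exists_mem_annulus (x := x) (v := v)
      (by rw [← hself]; exact M₂.mark_self_lt_one hne hpos)
    have h1 := M₂.eq_of_mem_annulus (fun h => hu.ne' (e.extend_injective h)) hne
      (e.mapsTo_annulus hu hxu) hpos
    rw [e.extend_injective h1] at hxu
    exact hx hxu

/-- The equivalence of trees of local models extending an isomorphism of first-return maps. -/
noncomputable def toTLMEquiv : TLMEquiv M₁ M₂ where
  tree := e.treeIso
  tree_map v := (e.isGood v).map_eq.symm
  tree_height := e.h_extend
  iso v := (e.extend v).2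
  isHolomorphicIsometry v := (e.isGood v).isMarked.isHolomorphicIsometry
  mark_iso := e.mark_extend
  conj x := ((e.isGood x.1).conj x.2).symm

lemma toTLMEquiv_incl (x : M₁.Spine) : e.toTLMEquiv.toMap (M₁.incl x) = M₂.incl (e.toMap x) := by
  obtain ⟨v, x⟩ := x
  change (⟨(e.extend v).1, (e.extend v).2 x⟩ : M₂.Total) = ⟨e.tree v, e.iso v x⟩
  rw [e.extend_spine v]

end SpineEquiv

namespace TLMEquiv

open TreeOfLocalModels

/-! ### Uniqueness of the extension -/

variable {V₁ V₂ : Type*} {T₁ : MetrizedPolynomialTree V₁} {T₂ : MetrizedPolynomialTree V₂}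
  {M₁ : TreeOfLocalModels.{u} T₁} {M₂ : TreeOfLocalModels.{u} T₂}

lemma degV_tree (E : TLMEquiv M₁ M₂) (v : V₁) : T₂.degV (E.tree v) = T₁.degV v :=
  (degV_eq_of_conj (i := E.iso v) (q := ⟨E.tree (T₁.F v), E.iso (T₁.F v)⟩)
    (E.isHolomorphicIsometry v).bijective (E.isHolomorphicIsometry (T₁.F v)).bijective
    fun x => (E.conj ⟨v, x⟩).symm).symm

lemma iso_mem_annulus (E : TLMEquiv M₁ M₂) {v u : V₁} {x : M₁.surf v} (hx : x ∈ M₁.annulus v u) :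
    E.iso v x ∈ M₂.annulus (E.tree v) (E.tree u) := by
  change 0 < (M₂.mark (E.tree v) (E.iso v x) : V₂ → ℝ) (E.tree u)
  rw [E.mark_iso, pushPoint_apply_of_injective E.tree.injective]
  exact hx

/-- An equivalence is determined by its restriction to the spine. -/
lemma toMap_eq_of_eqOn_spine {E E' : TLMEquiv M₁ M₂}
    (h : ∀ x : M₁.Spine, E.toMap (M₁.incl x) = E'.toMap (M₁.incl x)) : E.toMap = E'.toMap := by
  have key : ∀ v x, E.toMap ⟨v, x⟩ = E'.toMap ⟨v, x⟩ := by
    intro v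
    induction hn : T₁.depth v using Nat.strong_induction_on generalizing v with
    | _ n ih =>
      subst hn
      intro x
      by_cases hv : v ∈ T₁.spine
      · exact h ⟨⟨v, hv⟩, x⟩
      have hpos := T₁.depth_pos_of_notMem_spine hv
      have hadj := (T₁.adj_parent v).symm
      have htree : E.tree v = E'.tree v := by
        obtain ⟨y, hy⟩ := M₁.nonempty_annulus hadj
        have hz := ih _ (T₁.depth_parent_lt hpos) (T₁.parent v) rfl y
        have h1 : (E.toMap ⟨T₁.parent v, y⟩).2 ∈
            M₂.annulus (E.toMap ⟨T₁.parent v, y⟩).1 (E.tree v) :=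
          E.iso_mem_annulus hy
        have h2 : (E'.toMap ⟨T₁.parent v, y⟩).2 ∈
            M₂.annulus (E'.toMap ⟨T₁.parent v, y⟩).1 (E'.tree v) := E'.iso_mem_annulus hy
        have h3 : E.tree (T₁.parent v) = E'.tree (T₁.parent v) := congrArg Sigma.fst hz
        rw [hz] at h1
        refine M₂.eq_of_mem_annulus ?_ ?_ h1 h2
        · change E.tree v ≠ E'.tree (T₁.parent v)
          rw [← h3]
          exact fun hcon => hadj.ne' (E.tree.injective hcon)
        · exact fun hcon => hadj.ne' (E'.tree.injective hcon)
      refine M₂.totalMap_inj htree ?_ ?_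
      · change T₂.degV (E.tree v) = 1
        rw [E.degV_tree, T₁.degV_eq_one hv]
      · have h1 : E.toMap (M₁.totalMap ⟨v, x⟩) = M₂.totalMap (E.toMap ⟨v, x⟩) := E.conj ⟨v, x⟩
        have h2 : E'.toMap (M₁.totalMap ⟨v, x⟩) = M₂.totalMap (E'.toMap ⟨v, x⟩) := E'.conj ⟨v, x⟩
        rw [← h1, ← h2]
        exact ih _ (T₁.depth_map_lt hpos) (T₁.F v) rfl (M₁.map v x)
  funext ⟨v, x⟩
  exact key v x

end TLMEquiv

theorem proposition4p2 {V₁ V₂ : Type*}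
    {T₁ : MetrizedPolynomialTree V₁} {T₂ : MetrizedPolynomialTree V₂}
    (M₁ : TreeOfLocalModels.{u} T₁) (M₂ : TreeOfLocalModels.{u} T₂)
    (e : SpineEquiv M₁ M₂) :
    (∃ E : TLMEquiv M₁ M₂,
      (∀ x : M₁.Spine, E.toMap (M₁.incl x) = M₂.incl (e.toMap x)) ∧
      ∀ E' : TLMEquiv M₁ M₂,
        (∀ x : M₁.Spine, E'.toMap (M₁.incl x) = M₂.incl (e.toMap x)) → E'.toMap = E.toMap) ∧
    ∀ v ∉ T₁.spine, IsLocalModelMap (M₁.map v) 1 := by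
  refine ⟨⟨e.toTLMEquiv, e.toTLMEquiv_incl, fun E' hE' => ?_⟩, fun v hv => ?_⟩
  · exact TLMEquiv.toMap_eq_of_eqOn_spine fun x => (hE' x).trans (e.toTLMEquiv_incl x).symm
  · have := M₁.isLocalModelMap v
    rwa [T₁.degV_eq_one hv] at this
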